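/- Let $K$ be a field (of arbitrary characteristic), let $\Lambda=\Lambda(x_i\mid i\ge 0)$ be the Grassmann algebra over $K$ in the odd letters $x_0,x_1,\dots$, and let $\partial_i$ be the superderivative of $\Lambda$ with $\partial_i(x_j)=\delta_{ij}$. Identify $x_i$ with the operator of left multiplication by $x_i$, and regard $\operatorname{End}_K\Lambda$ as a Lie superalgebra with the supercommutator $[\varphi,\psi]=\varphi\psi-(-1)^{|\varphi||\psi|}\psi\varphi$. For $n\ge 0$ let $$v_n=\partial_n+x_nx_{n+1}\bigl(\partial_{n+3}+x_{n+3}x_{n+4}(\partial_{n+6}+x_{n+6}x_{n+7}(\partial_{n+9}+\cdots))\bigr)\in\operatorname{End}_K\Lambda ,$$ and let $\mathbf Q=\mathrm{Lie}(v_0,v_1,v_2)=\mathbf Q_{\bar 0}\oplus\mathbf Q_{\bar 1}$ be the Lie subsuperalgebra of $\operatorname{End}_K\Lambda$ generated by $v_0,v_1,v_2$ (in characteristic $2$, subsuperalgebras are also required to be closed under squares of odd elements). Write $\operatorname{ad}(a)(b)=[a,b]$ for $a,b\in\mathbf Q$. **Theorem.** $\mathbf Q=\mathbf Q_{\bar 0}\oplus\mathbf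 Q_{\bar 1}$ is a Lie superalgebra, and for every $a\in\mathbf Q_{\bar 0}\cup\mathbf Q_{\bar 1}$ the operator $\operatorname{ad}(a)\colon\mathbf Q\to\mathbf Q$ is nilpotent; that is, $\mathbf Q$ is a nil graded Lie superalgebra. Moreover, if $\operatorname{char}K=0$, then $\mathbf Q$ shows that the Martinez–Zelmanov theorem does not extend to Lie superalgebras (that theorem says that a Lie algebra over a field of characteristic zero, graded by an abelian group with components of uniformly bounded dimension and with all homogeneous elements $\operatorname{ad}$-nilpotent, is locally nilpotent). Namely, for $\gamma\in\mathbb Z^3$ let $\mathbf Q_\gamma$ be the span of all Lie products of multidegree $\gamma$ in $v_0,v_1,v_2$. Then $\mathbf Q=\bigoplus_{\gamma\in\mathbb Z^3}\mathbf Q_\gamma$ is a grading by $\mathbb Z^3$; each $\mathbf Q_\gamma$ lies in $\mathbf Q_{\overline{\gamma_1+\gamma_2+\gamma_3}}$; $\dim_K\mathbf Q_\gamma\le 1$ for all $\gamma$; and $\operatorname{ad}(a)$ is nilpotent for all $\gamma$ and all $a\in\mathbf Q_\gamma$; but $\mathbf Q$ is not locally nilpotent, i.e. some finitely generated subalgebra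 of $\mathbf Q$ is not nilpotent. -/

import Mathlib

namespace FractalQ

noncomputable section

/-! ### Lie superalgebras, gradings, nilpotency

A (nonassociative) algebra is a vector space `L` with a bilinear product
`br : L →ₗ[K] L →ₗ[K] L`; the operator `ad a` is `br a : Module.End K L`. -/

section General

variable {K : Type*} [Field K] {L : Type*} [AddCommGroup L] [Module K L]

/-- `L` with the even and odd parts `par 0`, `par 1` and the product `br` is a Lie superalgebra
over a field of arbitrary characteristic (with the usual additional axioms in characteristics
2 and 3; in characteristic 2 a formal square of odd elements is part of the structure). -/
structure IsLieSuperalgebra (par : ZMod 2 → Submodule K L) (br : L →ₗ[K] L →ₗ[K] L) : Prop where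
  isInternal : DirectSum.IsInternal par
  bracket_mem : ∀ i j : ZMod 2, ∀ a ∈ par i, ∀ b ∈ par j, br a b ∈ par (i + j)
  anticomm : ∀ i j : ZMod 2, ∀ a ∈ par i, ∀ b ∈ par j,
    br a b = -((-1 : K) ^ (i.val * j.val) • br b a)
  jacobi : ∀ i j : ZMod 2, ∀ a ∈ par i, ∀ b ∈ par j, ∀ c : L,
    br a (br b c) = br (br a b) c + (-1 : K) ^ (i.val * j.val) • br b (br a c)
  char_three : (3 : K) = 0 → ∀ z ∈ par 1, br z (br z z) = 0
  char_two : (2 : K) = 0 →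
    (∀ x ∈ par 0, br x x = 0) ∧
    ∃ sq : L → L,
      (∀ x ∈ par 1, sq x ∈ par 0) ∧
      (∀ (c : K), ∀ x ∈ par 1, sq (c • x) = c ^ 2 • sq x) ∧
      (∀ x ∈ par 1, ∀ y ∈ par 1, sq (x + y) = sq x + br x y + sq y) ∧
      (∀ x ∈ par 1, ∀ z : L, br x (br x z) = br (sq x) z)

/-- The subspaces `comp γ` form a grading of the algebra `L` by the abelian group `Γ`. -/
structure IsGroupGrading {Γ : Type*} [AddCommGroup Γ] [DecidableEq Γ]
    (comp : Γ → Submodule K L) (br : L →ₗ[K] L →ₗ[K] L) : Prop where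
  isInternal : DirectSum.IsInternal comp
  bracket_mem : ∀ γ δ : Γ, ∀ a ∈ comp γ, ∀ b ∈ comp δ, br a b ∈ comp (γ + δ)

/-- The subalgebra of `L` generated by a set `X`. -/
def generatedSubalgebra (br : L →ₗ[K] L →ₗ[K] L) (X : Set L) : Submodule K L :=
  sInf {S | X ⊆ S ∧ ∀ a ∈ S, ∀ b ∈ S, br a b ∈ S}

/-- The lower central series of a subalgebra `S`: it starts with `S`, and the next term is the
span of all products `[a, b]` with `a ∈ S` and `b` in the current term. -/
def lowerSeries (br : L →ₗ[K] L →ₗ[K] L) (S : Submodule K L) : ℕ → Submodule K L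
  | 0 => S
  | n + 1 => Submodule.span K {c | ∃ a ∈ S, ∃ b ∈ lowerSeries br S n, c = br a b}

/-- Every finitely generated subalgebra is nilpotent. -/
def IsLocallyNilpotent (br : L →ₗ[K] L →ₗ[K] L) : Prop :=
  ∀ X : Set L, X.Finite → ∃ n : ℕ, lowerSeries br (generatedSubalgebra br X) n = ⊥

end General

/-! ### The Grassmann algebra `Λ = Λ(x_0, x_1, x_2, …)` and its endomorphisms -/

variable (K : Type*) [Field K]

/-- The Grassmann algebra in the letters `x_i`, `i ≥ 0`. -/
abbrev Gr : Type _ := ExteriorAlgebra K (ℕ →₀ K)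

/-- The `ℤ/2`-grading of the Grassmann algebra, all letters being odd. -/
abbrev grParity (i : ZMod 2) : Submodule K (Gr K) :=
  CliffordAlgebra.evenOdd (0 : QuadraticForm K (ℕ →₀ K)) i

/-- The letter `x_i`, as the operator of left multiplication on `Λ`. -/
def xop (i : ℕ) : Module.End K (Gr K) :=
  LinearMap.mulLeft K (ExteriorAlgebra.ι K (Finsupp.single i (1 : K)))

/-- The superderivative `∂_i` of `Λ` with `∂_i (x_j) = δ_ij`: the left contraction by the
`i`-th coordinate functional. -/
def dop (i : ℕ) : Module.End K (Gr K) :=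
  CliffordAlgebra.contractLeft (Q := (0 : QuadraticForm K (ℕ →₀ K)))
    (Finsupp.lapply i : (ℕ →₀ K) →ₗ[K] K)

/-- The `k`-th summand `x_n x_{n+1} x_{n+3} x_{n+4} ⋯ x_{n+3k-3} x_{n+3k-2} ∂_{n+3k}` of the
pivot element `v_n`. -/
def pivotTerm : ℕ → ℕ → Module.End K (Gr K)
  | n, 0 => dop K n
  | n, k + 1 => xop K n * xop K (n + 1) * pivotTerm (n + 3) k

theorem dop_finite (f : Gr K) : {i : ℕ | dop K i f ≠ 0}.Finite := by
  induction f using CliffordAlgebra.left_induction with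
  | algebraMap r => simp [dop]
  | add a b ha hb =>
    refine (ha.union hb).subset fun i hi => ?_
    by_contra h
    simp only [Set.mem_union, Set.mem_ofPred_eq, not_or, not_not] at h
    exact hi (by rw [map_add, h.1, h.2, add_zero])
  | ι_mul a m ha =>
    refine (ha.union m.support.finite_toSet).subset fun i hi => ?_
    by_contra h
    simp only [Set.mem_union, Set.mem_ofPred_eq, not_or, not_not, Finset.mem_coe,
      Finsupp.mem_support_iff] at h
    refine hi ?_
    have h1 := h.1
    simp only [dop] at h1 ⊢
    rw [CliffordAlgebra.contractLeft_ι_mul, h1, Finsupp.lapply_apply, h.2]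
    simp

theorem pivotTerm_eq_zero (f : Gr K) (k : ℕ) :
    ∀ n : ℕ, dop K (n + 3 * k) f = 0 → pivotTerm K n k f = 0 := by
  induction k with
  | zero => intro n h; simpa [pivotTerm] using h
  | succ k ih =>
    intro n h
    have h' : dop K (n + 3 + 3 * k) f = 0 := by
      rw [show n + 3 + 3 * k = n + 3 * (k + 1) by ring]; exact h
    simp [pivotTerm, Module.End.mul_apply, ih (n + 3) h']

theorem pivotTerm_finite (n : ℕ) (f : Gr K) :
    (Function.support fun k => pivotTerm K n k f).Finite := by
  have h : Set.InjOn (fun k : ℕ => n + 3 * k)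
      ((fun k : ℕ => n + 3 * k) ⁻¹' {i : ℕ | dop K i f ≠ 0}) := by
    intro a _ b _ hab
    simp only at hab
    omega
  exact ((dop_finite K f).preimage h).subset fun k hk h0 => hk (pivotTerm_eq_zero K f k n h0)

/-- The pivot element
`v_n = ∂_n + x_n x_{n+1} (∂_{n+3} + x_{n+3} x_{n+4} (∂_{n+6} + ⋯))`; on every element of `Λ`
only finitely many summands are nonzero. -/
def pivot (n : ℕ) : Module.End K (Gr K) where
  toFun f := ∑ᶠ k, pivotTerm K n k f
  map_add' f g := by
    simp only [map_add]
    exact finsum_add_distrib (pivotTerm_finite K n f) (pivotTerm_finite K n g)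
  map_smul' c f := by
    simp only [map_smul, RingHom.id_apply]
    exact (smul_finsum' c (pivotTerm_finite K n f)).symm

/-- The even (`i = 0`) and odd (`i = 1`) endomorphisms of `Λ`. -/
def endParity (i : ZMod 2) : Submodule K (Module.End K (Gr K)) where
  carrier := {φ | ∀ j : ZMod 2, ∀ f ∈ grParity K j, φ f ∈ grParity K (j + i)}
  add_mem' ha hb j f hf := Submodule.add_mem _ (ha j f hf) (hb j f hf)
  zero_mem' _ _ _ := Submodule.zero_mem _
  smul_mem' c _ ha j f hf := Submodule.smul_mem _ c (ha j f hf)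

/-- The component of parity `i` of an endomorphism `φ` of `Λ`:
the sum over `j` of `p_{j+i} φ p_j`, where `p_j` is the projection of `Λ` on its `j`-part. -/
def parityComponent (i : ZMod 2) : Module.End K (Gr K) →ₗ[K] Module.End K (Gr K) :=
  ∑ j : ZMod 2,
    LinearMap.mulLeft K (A := Module.End K (Gr K)) (GradedAlgebra.proj (grParity K) (j + i)) ∘ₗ
    LinearMap.mulRight K (A := Module.End K (Gr K)) (GradedAlgebra.proj (grParity K) j)

/-- The supercommutator on `End Λ`, the bilinear map with
`[φ, ψ] = φ ψ - (-1)^{|φ||ψ|} ψ φ` for homogeneous `φ`, `ψ`. -/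
def superBracket :
    Module.End K (Gr K) →ₗ[K] Module.End K (Gr K) →ₗ[K] Module.End K (Gr K) :=
  LinearMap.mk₂ K
    (fun φ ψ => ∑ i : ZMod 2, ∑ j : ZMod 2,
      (parityComponent K i φ * parityComponent K j ψ
        - (-1 : K) ^ (i.val * j.val) • (parityComponent K j ψ * parityComponent K i φ)))
    (by
      intro a b c
      simp only [map_add, add_mul, mul_add, smul_add, ← Finset.sum_add_distrib]
      exact Finset.sum_congr rfl fun i _ => Finset.sum_congr rfl fun j _ => by abel)
    (by
      intro r a b
      simp only [map_smul, smul_mul_assoc, mul_smul_comm, Finset.smul_sum, smul_sub]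
      exact Finset.sum_congr rfl fun i _ => Finset.sum_congr rfl fun j _ => by
        rw [smul_comm r])
    (by
      intro a b c
      simp only [map_add, add_mul, mul_add, smul_add, ← Finset.sum_add_distrib]
      exact Finset.sum_congr rfl fun i _ => Finset.sum_congr rfl fun j _ => by abel)
    (by
      intro r a b
      simp only [map_smul, smul_mul_assoc, mul_smul_comm, Finset.smul_sum, smul_sub]
      exact Finset.sum_congr rfl fun i _ => Finset.sum_congr rfl fun j _ => by
        rw [smul_comm r])

/-! ### The Lie superalgebra `Q = Lie(v_0, v_1, v_2)` -/

/-- A subalgebra of the Lie superalgebra `End Λ`: a `ℤ/2`-graded subspace closed under the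
supercommutator and, in characteristic 2, under squares of odd elements. -/
structure IsLieSubsuperalgebra (S : Submodule K (Module.End K (Gr K))) : Prop where
  component_mem : ∀ (i : ZMod 2), ∀ a ∈ S, parityComponent K i a ∈ S
  bracket_mem : ∀ a ∈ S, ∀ b ∈ S, superBracket K a b ∈ S
  square_mem : (2 : K) = 0 → ∀ a ∈ S, a ∈ endParity K 1 → a * a ∈ S

/-- The Lie superalgebra generated by `v_0`, `v_1`, `v_2`. -/
def Q : Submodule K (Module.End K (Gr K)) :=
  sInf {S | IsLieSubsuperalgebra K S ∧ ∀ i : Fin 3, pivot K i ∈ S}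

theorem Q_bracket_mem (a b : Q K) : superBracket K a b ∈ Q K := by
  refine (Submodule.mem_sInf).2 fun S hS => ?_
  exact hS.1.bracket_mem _ ((Submodule.mem_sInf).1 a.2 S hS) _ ((Submodule.mem_sInf).1 b.2 S hS)

/-- The supercommutator of `Q`; thus `qBracket K a` is the operator `ad a` on `Q`. -/
def qBracket : Q K →ₗ[K] Q K →ₗ[K] Q K :=
  LinearMap.mk₂ K (fun a b => ⟨superBracket K a b, Q_bracket_mem K a b⟩)
    (fun _ _ _ => Subtype.ext (by simp))
    (fun _ _ _ => Subtype.ext (by simp))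
    (fun _ _ _ => Subtype.ext (by simp))
    (fun _ _ _ => Subtype.ext (by simp))

/-- The even (`i = 0`) and the odd (`i = 1`) part of `Q`. -/
def qParity (i : ZMod 2) : Submodule K (Q K) :=
  (endParity K i).comap (Q K).subtype

/-- The generators `v_0`, `v_1`, `v_2` of `Q`. -/
def qGen (i : Fin 3) : Q K :=
  ⟨pivot K i, (Submodule.mem_sInf).2 fun _ hS => hS.2 i⟩

/-- `IsLieProduct K n a`: the element `a` of `Q` is a Lie product of multidegree
`n = (n_1, n_2, n_3)` in the generators `v_0`, `v_1`, `v_2` (in characteristic 2, squares of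
odd products are also products). -/
inductive IsLieProduct : (Fin 3 → ℕ) → Q K → Prop
  | gen (i : Fin 3) : IsLieProduct (Pi.single i 1) (qGen K i)
  | bracket {m n : Fin 3 → ℕ} {a b : Q K} :
      IsLieProduct m a → IsLieProduct n b → IsLieProduct (m + n) (qBracket K a b)
  | square {m : Fin 3 → ℕ} {a b : Q K} :
      (2 : K) = 0 → IsLieProduct m a → a ∈ qParity K 1 →
      (b : Module.End K (Gr K)) = (a : Module.End K (Gr K)) * (a : Module.End K (Gr K)) →
      IsLieProduct (m + m) b

/-- The component of `Q` of multidegree `γ ∈ ℤ³` in the generators (it is zero if `γ` has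
a negative entry). -/
def qComponent (γ : Fin 3 → ℤ) : Submodule K (Q K) :=
  Submodule.span K {a | ∃ n : Fin 3 → ℕ, (∀ i, (n i : ℤ) = γ i) ∧ IsLieProduct K n a}

end

end FractalQ

namespace FractalQ

noncomputable section

/-! ### Letters, derivations and pivot elements as an abstract system of operators -/

section Operators

variable {K : Type*} [Field K] {M : Type*} [AddCommGroup M] [Module K M]

/-! Everything rests on the recursion `v_n = ∂_n + x_n x_{n+1} v_{n+3}`, which gives `v_n² = x_{n+1}
v_{n+3}` and, on bracketing with `v_{n+1}`, `[v_n, [v_n, v_{n+1}]] = -v_{n+3}`. The last relation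
produces all pivots inside `Q` with arbitrarily many brackets, and no pivot is zero, so `Q` is not
locally nilpotent.

For an upper bound on `Q`, call `x_L v_n` admitted if its letters are among `x_0, …, x_{n-2}` and
`x_{n-3}`, `x_{n-2}` do not both occur. The span of these monomials is closed under brackets and
squares (`sbr_word_mul_v_mem`, `mul_self_mem_monoPart`), so it contains `Q`. Give `v_n` the weight
`w_n ∈ ℤ³` with `w_{n+3} = 2 w_n + w_{n+1}`, and `x_n` the weight `-w_n`; then `v_n` is homogeneous.
An admitted monomial with distinct letters is determined by its weight, up to sign: the letters are
binary digits that can be read off modulo 2, and the only coincidence would need the forbidden pair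
(`IsDigits.eq_or_pair`). Hence the components have dimension at most one. They are independent in
characteristic zero because rescaling the letters acts on them by distinct characters.

For nilpotency, an odd `a` satisfies `ad(a)² = ad(a²)`, and an even `a` has nilpotent `ad(a)` once
`a` is a nilpotent operator. Let `a` be even and `N` large, and write `a = S + B`, where `S`
collects the terms with `∂_i`, `i < N`. A positive linear functional of the weight, the height, is
positive on every admitted nonzero monomial, so `S` moves strictly in a bounded grading and is
nilpotent. An even monomial has an odd number of letters, so `S` does not lower the degree in `x_0,
…, x_{N-1}` while `B` raises it. If `S^P = 0`, every term of `(S + B)^P` contains `B`, so `a^P`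
raises a bounded degree and is nilpotent (`isNilpotent_of_even`). -/

/-- The product of the operators `X i` over a word `L`. -/
def word (X : ℕ → Module.End K M) (L : List ℕ) : Module.End K M := (L.map X).prod

/-- Operators `X i`, `D i`, `V i` that satisfy the relations of the letters, the superderivatives
and the pivot elements of the Grassmann algebra, with vacuum vector `e`. -/
structure IsPivotSystem (X D V : ℕ → Module.End K M) (e : M) : Prop where
  x_mul_self : ∀ i, X i * X i = 0
  x_mul_x : ∀ i j, X i * X j = -(X j * X i)
  d_mul_self : ∀ i, D i * D i = 0
  d_mul_d : ∀ i j, D i * D j = -(D j * D i)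
  d_mul_x : ∀ i j, D i * X j = (if i = j then 1 else 0) - X j * D i
  v_eq : ∀ n, V n = D n + X n * X (n + 1) * V (n + 3)
  v_eventually : ∀ f : M, ∃ N, ∀ n, N ≤ n → V n f = 0
  d_vacuum : ∀ i, D i e = 0
  span_word : Submodule.span K (Set.range fun L => word X L e) = ⊤

theorem mul_pair_of_anticommute {A : Type*} [Ring A] {D x y : A} (hx : D * x = -(x * D))
    (hy : D * y = -(y * D)) : D * (x * y) = x * y * D := by
  rw [← mul_assoc, hx, neg_mul, mul_assoc, hy, mul_neg, neg_neg, mul_assoc]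

namespace IsPivotSystem

variable {X D V : ℕ → Module.End K M} {e : M} (h : IsPivotSystem X D V e)
include h

theorem d_mul_x_of_ne {i j : ℕ} (hij : i ≠ j) : D i * X j = -(X j * D i) := by
  rw [h.d_mul_x, if_neg hij, zero_sub]

/-- An infinite sum is handled one vector `f` at a time: `V m f` and `V m (E f)` vanish for large
`m`, and the recursion for `V` carries the identity down from there in steps of three. -/
theorem mul_v_of_anticommute {E : Module.End K M} {n : ℕ}
    (hx : ∀ i, n ≤ i → E * X i = -(X i * E)) (hd : ∀ i, n ≤ i → E * D i = -(D i * E)) :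
    E * V n = -(V n * E) := by
  refine LinearMap.ext fun f => ?_
  obtain ⟨N₁, h₁⟩ := h.v_eventually f
  obtain ⟨N₂, h₂⟩ := h.v_eventually (E f)
  suffices ∀ d m, n ≤ m → N₁ + N₂ ≤ m + d → (E * V m) f = (-(V m * E)) f from
    this (N₁ + N₂) n le_rfl (by omega)
  intro d
  induction d with
  | zero =>
    intro m _ hN
    simp [h₁ m (by omega), h₂ m (by omega)]
  | succ d ih =>
    intro m hm hN
    have h3 := ih (m + 3) (by omega) (by omega)
    have h4 : E * V m = -(D m * E) + X m * X (m + 1) * (E * V (m + 3)) := by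
      rw [h.v_eq m, mul_add, hd m hm, ← mul_assoc,
        mul_pair_of_anticommute (hx m hm) (hx (m + 1) (by omega)), mul_assoc]
    have h5 : -(V m * E) = -(D m * E) + X m * X (m + 1) * -(V (m + 3) * E) := by
      rw [h.v_eq m]; noncomm_ring
    rw [h4, h5, LinearMap.add_apply, LinearMap.add_apply, Module.End.mul_apply (X m * X (m + 1)),
      h3, ← Module.End.mul_apply]

theorem x_mul_v {i n : ℕ} (hi : i < n) : X i * V n = -(V n * X i) :=
  h.mul_v_of_anticommute (fun j _ => h.x_mul_x i j) fun j hj => by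
    rw [h.d_mul_x_of_ne (by omega : j ≠ i), neg_neg]

theorem d_mul_v {i n : ℕ} (hi : i < n) : D i * V n = -(V n * D i) :=
  h.mul_v_of_anticommute (fun j hj => h.d_mul_x_of_ne (by omega)) fun j _ => h.d_mul_d i j

theorem v_mul_x {i n : ℕ} (hi : i < n) : V n * X i = -(X i * V n) := by
  rw [h.x_mul_v hi, neg_neg]

theorem v_mul_pair {i j n : ℕ} (hi : i < n) (hj : j < n) :
    V n * (X i * X j) = X i * X j * V n :=
  mul_pair_of_anticommute (h.v_mul_x hi) (h.v_mul_x hj)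

theorem x_mul_pair (i j k : ℕ) : X k * (X i * X j) = X i * X j * X k :=
  mul_pair_of_anticommute (h.x_mul_x _ _) (h.x_mul_x _ _)

theorem v_x_anticomm_step (n m : ℕ) :
    V n * X m + X m * V n = (if n = m then 1 else 0) +
      X n * X (n + 1) * (V (n + 3) * X m + X m * V (n + 3)) := by
  rw [h.v_eq n, add_mul, mul_add, h.d_mul_x, ← mul_assoc (X m), h.x_mul_pair]
  noncomm_ring

theorem v_x_anticomm_of_lt {n m : ℕ} (hm : m < n) : V n * X m + X m * V n = 0 := by
  rw [h.v_mul_x hm, neg_add_cancel]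

theorem v_x_anticomm_self (n : ℕ) : V n * X n + X n * V n = 1 := by
  rw [h.v_x_anticomm_step, h.v_x_anticomm_of_lt (by omega : n < n + 3), if_pos rfl]
  simp

/-- The square of a pivot element. -/
theorem v_mul_self (n : ℕ) : V n * V n = X (n + 1) * V (n + 3) := by
  have hp := h.v_mul_pair (by omega : n < n + 3) (by omega : n + 1 < n + 3)
  have hd := h.d_mul_v (by omega : n < n + 3)
  have h1 : D n * (X n * X (n + 1)) = X (n + 1) + X n * X (n + 1) * D n := by
    rw [← mul_assoc, h.d_mul_x, if_pos rfl, sub_mul, one_mul, mul_assoc _ (D n),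
      h.d_mul_x_of_ne (by omega : n ≠ n + 1)]
    noncomm_ring
  have h2 : X n * X (n + 1) * (X n * X (n + 1)) = 0 := by
    rw [mul_assoc, h.x_mul_pair, ← mul_assoc, ← mul_assoc, h.x_mul_self, zero_mul, zero_mul]
  have h0 := h.d_mul_self n
  rw [h.v_eq n]
  generalize X n * X (n + 1) = Y at *
  generalize V (n + 3) = W at *
  calc (D n + Y * W) * (D n + Y * W)
      = D n * D n + (D n * Y) * W + Y * (W * D n) + Y * (W * Y) * W := by
        noncomm_ring
    _ = _ := by
        rw [h0, h1, hp, ← mul_assoc Y Y, h2, add_mul, mul_assoc Y (D n), hd]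
        noncomm_ring

/-- The head `D n` anticommutes with `V m`, and `X n * X (n + 1)` commutes with it because both
letters lie below `m`; only the tail contributes. -/
theorem v_anticomm_step {n m : ℕ} (hm : n + 2 ≤ m) :
    V n * V m + V m * V n = X n * X (n + 1) * (V (n + 3) * V m + V m * V (n + 3)) := by
  rw [h.v_eq n, add_mul, mul_add, h.d_mul_v (by omega : n < m), ← mul_assoc (V m),
    h.v_mul_pair (by omega : n < m) (by omega : n + 1 < m)]
  noncomm_ring

/-- The bracket of `V (n + 1)` and `V (n + 3)` begins with the letter `X (n + 1)`, whose square is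
zero. -/
theorem x_succ_mul_v_anticomm (n : ℕ) :
    X (n + 1) * (V (n + 3) * V (n + 1) + V (n + 1) * V (n + 3)) = 0 := by
    rw [add_comm (V (n + 3) * _), h.v_anticomm_step (by omega : n + 1 + 2 ≤ n + 3), mul_assoc,
      ← mul_assoc, h.x_mul_self, zero_mul]

theorem v_anticomm_succ (n : ℕ) :
    V n * V (n + 1) + V (n + 1) * V n = -(X n * V (n + 3)) := by
  have e : V (n + 1) * (X n * X (n + 1)) = -X n + X n * X (n + 1) * V (n + 1) := by
    rw [← mul_assoc, h.v_mul_x (by omega : n < n + 1), neg_mul, mul_assoc,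
      eq_sub_of_add_eq (h.v_x_anticomm_self (n + 1))]
    noncomm_ring
  rw [h.v_eq n, add_mul, mul_add, h.d_mul_v (by omega : n < n + 1), ← mul_assoc (V (n + 1)), e]
  calc _ = X n * (X (n + 1) * (V (n + 3) * V (n + 1) +
      V (n + 1) * V (n + 3))) - X n * V (n + 3) := by noncomm_ring
    _ = _ := by rw [h.x_succ_mul_v_anticomm]; noncomm_ring

theorem v_anticomm_succ_succ (n : ℕ) :
    V n * V (n + 2) + V (n + 2) * V n = -(X n * X (n + 1) * X (n + 2) * V (n + 5)) := by
  rw [h.v_anticomm_step le_rfl, add_comm (V (n + 3) * _), h.v_anticomm_succ]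
  noncomm_ring

/-- The square of `V n` carries the letter `X (n + 1)`, and `V (n + 1)` differentiates it away. This
relation generates all pivots from the first three. -/
theorem v_sq_comm_v_succ (n : ℕ) :
    V n * V n * V (n + 1) - V (n + 1) * (V n * V n) = -V (n + 3) := by
  calc V n * V n * V (n + 1) - V (n + 1) * (V n * V n)
      = X (n + 1) * (V (n + 3) * V (n + 1) + V (n + 1) * V (n + 3)) -
        (V (n + 1) * X (n + 1) + X (n + 1) * V (n + 1)) * V (n + 3) := by
        rw [h.v_mul_self]; noncomm_ring
    _ = _ := by rw [h.x_succ_mul_v_anticomm, h.v_x_anticomm_self]; noncomm_ring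

end IsPivotSystem

end Operators

/-! ### Weights -/

section Weights

/-- The words `L` such that the monomial `x_L v_n` is admitted: its letters are among
`x_0, …, x_{n-2}`, and `x_{n-3}`, `x_{n-2}` do not both occur. -/
def Adm (L : List ℕ) (n : ℕ) : Prop :=
  (∀ i ∈ L, i + 2 ≤ n) ∧ ∀ k, k + 3 = n → k ∈ L → k + 1 ∉ L

/-- Letters of index at most `n - 4` lie below the critical pair `n - 3`, `n - 2`, so they can be
added freely. -/
theorem Adm.of_forall_mem {L L' : List ℕ} {n : ℕ} (h' : Adm L' n)
    (h : ∀ i ∈ L, i ∈ L' ∨ i + 4 ≤ n) : Adm L n := by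
  refine ⟨fun i hi => ?_, fun k hk h1 h2 => ?_⟩
  · rcases h i hi with h1 | h1
    · exact h'.1 i h1
    · omega
  · rcases h _ h1 with h3 | h3
    · rcases h _ h2 with h4 | h4
      · exact h'.2 k hk h3 h4
      · omega
    · omega

theorem adm_nil (n : ℕ) : Adm [] n := by simp [Adm]

/-- The multidegree of the pivot element `v_n` in `v_0`, `v_1`, `v_2`. -/
def pivotWeight : ℕ → Fin 3 → ℤ
  | 0 => ![1, 0, 0]
  | 1 => ![0, 1, 0]
  | 2 => ![0, 0, 1]
  | n + 3 => 2 • pivotWeight n + pivotWeight (n + 1)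

theorem pivotWeight_add_three (n : ℕ) :
    pivotWeight (n + 3) = 2 • pivotWeight n + pivotWeight (n + 1) := by
  rw [pivotWeight]

/-- The multidegree of the monomial `x_L v_n`. -/
def monoWeight (L : List ℕ) (n : ℕ) : Fin 3 → ℤ := pivotWeight n - (L.map pivotWeight).sum

/-! ### Heights: positivity of admitted monomials -/

/-- A positive weight of the pivot elements with the recursion of `pivotWeight`. -/
def height : ℕ → ℕ
  | 0 => 2
  | 1 => 3
  | 2 => 5
  | n + 3 => 2 * height n + height (n + 1)

theorem height_add_three (n : ℕ) : height (n + 3) = 2 * height n + height (n + 1) := by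
  rw [height]

theorem height_le_succ : ∀ n, height n ≤ height (n + 1)
  | 0 => by simp [height]
  | 1 => by simp [height]
  | 2 => by simp [height]
  | n + 3 => by
    have h1 := height_le_succ n
    have h2 := height_le_succ (n + 1)
    have h3 := height_add_three n
    have h4 : height (n + 3 + 1) = _ := height_add_three (n + 1)
    omega

/-- Sum the recursion for `height`. The constant is `height 1 + height 2`: the term `height 0` is
already counted in the last sum. -/
theorem sum_height_add_three (n : ℕ) : ∑ i ∈ Finset.range (n + 3), height i =
    8 + 2 * ∑ i ∈ Finset.range n, height i + ∑ i ∈ Finset.range (n + 1), height i := by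
  induction n with
  | zero => simp [Finset.sum_range_succ, height]
  | succ n ih =>
    rw [Finset.sum_range_succ _ (n + 3), ih, Finset.sum_range_succ _ (n + 1),
      Finset.sum_range_succ _ n, height_add_three]
    ring

/-- The slack `4` makes the induction close exactly, as `8 - 2·4 - 4 + 4 = 0`, and the initial
heights `2, 3, 5` satisfy the three base cases. -/
theorem sum_height_le : ∀ n, ∑ i ∈ Finset.range n, height i + 4 ≤ 2 * height n
  | 0 => by simp [height]
  | 1 => by simp [height]
  | 2 => by simp [height, Finset.sum_range_succ]
  | n + 3 => by
    have h1 := sum_height_le n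
    have h2 := sum_height_le (n + 1)
    have h3 := height_add_three n
    have h4 := sum_height_add_three n
    omega

/-- The admitted monomials without repeated letters have positive weight. -/
theorem Adm.sum_height_lt {L : List ℕ} {n : ℕ} (h : Adm L n) (hL : L.Nodup) :
    (L.map height).sum < height n := by
  rw [← List.sum_toFinset _ hL]
  have key : ∀ m, L.toFinset ⊆ Finset.range m →
      ∑ i ∈ L.toFinset, height i ≤ ∑ i ∈ Finset.range m, height i :=
    fun m hm => Finset.sum_le_sum_of_subset hm
  match n, h with
  | 0, h =>
    refine (key 0 fun i hi => ?_).trans_lt (by simp [height])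
    have := h.1 i (List.mem_toFinset.1 hi)
    omega
  | 1, h =>
    refine (key 0 fun i hi => ?_).trans_lt (by simp [height])
    have := h.1 i (List.mem_toFinset.1 hi)
    omega
  | 2, h =>
    refine (key 1 fun i hi => ?_).trans_lt (by simp [height])
    have := h.1 i (List.mem_toFinset.1 hi)
    simp only [Finset.mem_range]; omega
  | k + 3, h =>
    have h1 := sum_height_le k
    have h2 := height_add_three k
    by_cases hk : k + 1 ∈ L.toFinset
    · rw [← Finset.add_sum_erase _ _ hk]
      have : L.toFinset.erase (k + 1) ⊆ Finset.range k := fun i hi => by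
        rw [Finset.mem_erase, List.mem_toFinset] at hi
        have h3 := h.1 i hi.2
        have h4 : i ≠ k := fun e => h.2 k rfl (e ▸ hi.2) (List.mem_toFinset.1 hk)
        simp only [Finset.mem_range]; omega
      have := Finset.sum_le_sum_of_subset (f := height) this
      omega
    -- Otherwise all letters are at most `k`, with total at most `3 * height k - 4`.
    · refine (key (k + 1) fun i hi => ?_).trans_lt ?_
      · have h3 := h.1 i (List.mem_toFinset.1 hi)
        have h4 : i ≠ k + 1 := fun e => hk (e ▸ hi)
        simp only [Finset.mem_range]; omega
      · rw [Finset.sum_range_succ]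
        have := height_le_succ k
        omega

/-! ### Digit expansions in the weights of the pivots -/

/-- The linear map that takes the multidegree of `v_n` to that of `v_{n+1}`. -/
def weightShift : (Fin 3 → ℤ) →+ (Fin 3 → ℤ) where
  toFun v := ![2 * v 2, v 0 + v 2, v 1]
  map_zero' := by ext i; fin_cases i <;> simp
  map_add' v w := by ext i; fin_cases i <;> simp <;> ring

theorem weightShift_apply (v : Fin 3 → ℤ) : weightShift v = ![2 * v 2, v 0 + v 2, v 1] := rfl

theorem weightShift_injective : Function.Injective weightShift := by
  intro v w h
  have h0 := congrFun h 0
  have h1 := congrFun h 1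
  have h2 := congrFun h 2
  simp [weightShift_apply] at h0 h1 h2
  ext i; fin_cases i <;> simp <;> omega

theorem weightShift_pivotWeight : ∀ n, weightShift (pivotWeight n) = pivotWeight (n + 1)
  | 0 => by ext i; fin_cases i <;> simp [weightShift_apply, pivotWeight]
  | 1 => by ext i; fin_cases i <;> simp [weightShift_apply, pivotWeight]
  | 2 => by ext i; fin_cases i <;> simp [weightShift_apply, pivotWeight]
  | n + 3 => by
    rw [pivotWeight_add_three, map_add, map_nsmul, weightShift_pivotWeight n,
      weightShift_pivotWeight (n + 1), pivotWeight_add_three (n + 1)]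

/-- The weighted sum of the digits `ξ 0, …, ξ (n - 1)`. -/
def digitSum (ξ : ℕ → ℤ) (n : ℕ) : Fin 3 → ℤ := ∑ i ∈ Finset.range n, ξ i • pivotWeight i

theorem digitSum_succ (ξ : ℕ → ℤ) (n : ℕ) : digitSum ξ (n + 1) =
    ξ 0 • pivotWeight 0 + weightShift (digitSum (fun i => ξ (i + 1)) n) := by
  rw [digitSum, Finset.sum_range_succ', add_comm, digitSum, map_sum]
  simp only [map_zsmul, weightShift_pivotWeight]

/-- The first coordinate of a shifted vector is even and that of `pivotWeight 0` is `1`, so the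
lowest digit is seen modulo 2. -/
theorem eq_of_smul_add_weightShift {a b : ℤ} {v w : Fin 3 → ℤ} (ha : a = 0 ∨ a = 1)
    (hb : b = 0 ∨ b = 1)
    (h : a • pivotWeight 0 + weightShift v = b • pivotWeight 0 + weightShift w) :
    a = b ∧ v = w := by
  have h0 := congrFun h 0
  simp [weightShift_apply, pivotWeight] at h0
  have hab : a = b := by omega
  subst hab
  exact ⟨rfl, weightShift_injective (add_left_cancel h)⟩

/-- Sequences of binary digits that vanish from `n - 1` on. -/
def IsDigits (ξ : ℕ → ℤ) (n : ℕ) : Prop := (∀ i, ξ i = 0 ∨ ξ i = 1) ∧ ∀ i, n < i + 2 → ξ i = 0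

theorem IsDigits.shift {ξ : ℕ → ℤ} {n : ℕ} (h : IsDigits ξ (n + 1)) :
    IsDigits (fun i => ξ (i + 1)) n :=
  ⟨fun i => h.1 (i + 1), fun i hi => h.2 (i + 1) (by omega)⟩

/-- The only such expansions are iterates of `w_3 = 2 w_0 + w_1`, with digits `1 1 0 1 1 0 … 1 1`;
the induction removes one block `1 1 0` and lowers `n` by three. -/
theorem IsDigits.pair_of_pivotWeight_eq (n : ℕ) : ∀ ξ : ℕ → ℤ, IsDigits ξ n → 0 < n →
    pivotWeight n = pivotWeight 0 + digitSum ξ n → ∃ k, k + 3 = n ∧ ξ k = 1 ∧ ξ (k + 1) = 1 := by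
  induction n using Nat.strong_induction_on with
  | _ n ih =>
    intro ξ hξ hn he
    obtain ⟨n, rfl⟩ : ∃ m, n = m + 1 := ⟨n - 1, by omega⟩
    have e1 : ξ 0 = 1 ∧ pivotWeight n + pivotWeight 0 =
        pivotWeight 2 + digitSum (fun i => ξ (i + 1)) n := by
      have h3 : 2 • pivotWeight 0 = pivotWeight 3 - pivotWeight 1 := by
        rw [pivotWeight_add_three 0]; simp
      have hx : ξ 0 = 1 := by
        rcases hξ.1 0 with h0 | h0
        · rw [digitSum_succ, h0, ← weightShift_pivotWeight] at he
          have h0 := congrFun he 0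
          simp [weightShift_apply, pivotWeight] at h0
          omega
        · exact h0
      -- Since `ξ 0 = 1`, the right side contains `2 w_0`. Adding `w_1` to both sides turns this
      -- into `w_3`, and then both sides are shifts.
      refine ⟨hx, weightShift_injective ?_⟩
      rw [map_add, map_add, weightShift_pivotWeight, weightShift_pivotWeight,
        weightShift_pivotWeight, he, digitSum_succ, hx, pivotWeight_add_three 0]
      module
    obtain ⟨h0, he⟩ := e1
    have hξ := hξ.shift
    match n, he, hξ with
    | 0, he, hξ =>
      have h0 := congrFun he 0
      simp [digitSum, pivotWeight] at h0
    | 1, he, hξ =>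
      have h1 := hξ.2 0 (by omega)
      have h0 := congrFun he 0
      simp [digitSum, pivotWeight, h1] at h0
    | n + 2, he, hξ =>
      -- Two more digits are read off, `1` from the summand `w_0` on the left and then `0`; the
      -- original equation returns with `n` in place of `n + 3`.
      rw [digitSum_succ, ← weightShift_pivotWeight (n + 1), ← weightShift_pivotWeight 1] at he
      obtain ⟨h1, he⟩ := eq_of_smul_add_weightShift (Or.inr rfl) (hξ.1 0)
        (v := pivotWeight (n + 1)) (a := 1)
        (w := pivotWeight 1 + digitSum (fun i => ξ (i + 1 + 1)) (n + 1)) (by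
          rw [one_smul, add_comm, he, map_add]; abel)
      have hξ := hξ.shift
      rw [digitSum_succ, ← weightShift_pivotWeight n, ← weightShift_pivotWeight 0] at he
      obtain ⟨h2, he⟩ := eq_of_smul_add_weightShift (Or.inl rfl) (hξ.1 0)
        (v := pivotWeight n) (a := 0)
        (w := pivotWeight 0 + digitSum (fun i => ξ (i + 1 + 1 + 1)) n) (by
          rw [zero_smul, zero_add, he, map_add]; abel)
      rcases Nat.eq_zero_or_pos n with rfl | hn
      · exact ⟨0, rfl, h0, h1.symm⟩
      · obtain ⟨k, hk, h3, h4⟩ := ih n (by omega) _ hξ.shift hn he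
        exact ⟨k + 3, by omega, h3, h4⟩

/-- Equal lowest digits are cancelled and both sides unshifted until `m = 0`, where the equation
becomes that of `pair_of_pivotWeight_eq`. -/
theorem IsDigits.eq_or_pair (m : ℕ) : ∀ n, m ≤ n → ∀ ξ η : ℕ → ℤ, IsDigits ξ n → IsDigits η m →
    pivotWeight n + digitSum η m = pivotWeight m + digitSum ξ n →
    (n = m ∧ ξ = η) ∨ ∃ k, k + 3 = n ∧ ξ k = 1 ∧ ξ (k + 1) = 1 := by
  induction m with
  | zero =>
    intro n _ ξ η hξ hη he
    rcases Nat.eq_zero_or_pos n with rfl | hn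
    · exact Or.inl ⟨rfl, funext fun i => by rw [hξ.2 i (by omega), hη.2 i (by omega)]⟩
    · refine Or.inr (hξ.pair_of_pivotWeight_eq n ξ hn ?_)
      simpa [digitSum] using he
  | succ m ih =>
    intro n hmn ξ η hξ hη he
    obtain ⟨n, rfl⟩ : ∃ k, n = k + 1 := ⟨n - 1, by omega⟩
    rw [digitSum_succ, digitSum_succ, ← weightShift_pivotWeight, ← weightShift_pivotWeight] at he
    obtain ⟨h0, he⟩ := eq_of_smul_add_weightShift (hη.1 0) (hξ.1 0)
      (v := pivotWeight n + digitSum (fun i => η (i + 1)) m)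
      (w := pivotWeight m + digitSum (fun i => ξ (i + 1)) n) (by
        rw [map_add, map_add, add_left_comm, he]; abel)
    rcases ih n (by omega) _ _ hξ.shift hη.shift he with ⟨h1, h2⟩ | ⟨k, hk, h1, h2⟩
    · refine Or.inl ⟨by omega, funext fun i => ?_⟩
      cases i with
      | zero => exact h0.symm
      | succ i => exact congrFun h2 i
    · exact Or.inr ⟨k + 1, by omega, h1, h2⟩

theorem digitSum_indicator {L : List ℕ} {n : ℕ} (hL : L.Nodup) (h : ∀ i ∈ L, i + 2 ≤ n) :
    digitSum (fun i => if i ∈ L then 1 else 0) n = (L.map pivotWeight).sum := by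
  rw [← List.sum_toFinset _ hL, digitSum]
  simp only [ite_smul, one_smul, zero_smul, ← List.mem_toFinset]
  rw [← Finset.sum_filter]
  refine Finset.sum_congr (Finset.ext fun i => ?_) fun _ _ => rfl
  simp only [Finset.mem_filter, Finset.mem_range, List.mem_toFinset, and_iff_right_iff_imp]
  intro hi
  have := h i hi
  omega

theorem Adm.isDigits {L : List ℕ} {n : ℕ} (h : Adm L n) :
    IsDigits (fun i => if i ∈ L then 1 else 0) n := by
  refine ⟨fun i => ?_, fun i hi => if_neg fun hiL => ?_⟩
  · by_cases hi : i ∈ L <;> simp [hi]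
  · have := h.1 i hiL
    omega

/-- An admitted monomial without repeated letters is determined by its weight, up to the order of
the letters. -/
theorem Adm.eq_of_monoWeight_eq {L L' : List ℕ} {n m : ℕ} (h : Adm L n) (hL : L.Nodup)
    (h' : Adm L' m) (hL' : L'.Nodup) (he : monoWeight L n = monoWeight L' m) :
    n = m ∧ L.Perm L' := by
  wlog hmn : m ≤ n generalizing L L' n m
  · obtain ⟨h1, h2⟩ := this h' hL' h hL he.symm (by omega)
    exact ⟨h1.symm, h2.symm⟩
  have he' : pivotWeight n + digitSum (fun i => if i ∈ L' then 1 else 0) m =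
      pivotWeight m + digitSum (fun i => if i ∈ L then 1 else 0) n := by
    rw [digitSum_indicator hL h.1, digitSum_indicator hL' h'.1]
    exact sub_eq_sub_iff_add_eq_add.1 he
  rcases IsDigits.eq_or_pair m n hmn _ _ h.isDigits h'.isDigits he' with ⟨h1, h2⟩ | ⟨k, hk, h1, h2⟩
  · refine ⟨h1, (List.perm_ext_iff_of_nodup hL hL').2 fun i => ?_⟩
    have := congrFun h2 i
    by_cases h3 : i ∈ L <;> by_cases h4 : i ∈ L' <;> simp_all
  · exact absurd (by simpa using h2) (h.2 k hk (by simpa using h1))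

end Weights

/-! ### Words and their products -/

section Words

variable {K : Type*} [Field K] {M : Type*} [AddCommGroup M] [Module K M]

theorem neg_one_pow_zmod_val (a b : ℕ) :
    (-1 : K) ^ ((a : ZMod 2).val * (b : ZMod 2).val) = (-1) ^ (a * b) := by
  rw [ZMod.val_natCast, ZMod.val_natCast, neg_one_pow_eq_pow_mod_two, ← Nat.mul_mod,
    ← neg_one_pow_eq_pow_mod_two]

/-- The supercommutator of elements `a`, `b` of parities `p`, `q`. -/
def sbr (p q : ZMod 2) (a b : Module.End K M) : Module.End K M :=
  a * b - (-1 : K) ^ (p.val * q.val) • (b * a)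

theorem sbr_swap (p q : ZMod 2) (a b : Module.End K M) :
    sbr p q a b = -((-1 : K) ^ (p.val * q.val) • sbr q p b a) := by
  have : (-1 : K) ^ (p.val * q.val) * (-1 : K) ^ (p.val * q.val) = 1 := by
    rw [← mul_pow]; simp
  rw [sbr, sbr, mul_comm q.val, smul_sub, smul_smul, this, one_smul]
  abel

@[simp] theorem word_nil (X : ℕ → Module.End K M) : word X [] = 1 := rfl

theorem word_cons (X : ℕ → Module.End K M) (i : ℕ) (L : List ℕ) :
    word X (i :: L) = X i * word X L := by simp [word]

theorem word_append (X : ℕ → Module.End K M) (L L' : List ℕ) :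
    word X (L ++ L') = word X L * word X L' := by simp [word]

theorem mul_word_of_anticommute {X : ℕ → Module.End K M} {E : Module.End K M} (L : List ℕ)
    (hE : ∀ i ∈ L, E * X i = -(X i * E)) :
    E * word X L = (-1 : K) ^ L.length • (word X L * E) := by
  induction L with
  | nil => simp
  | cons i L ih =>
    rw [word_cons, ← mul_assoc, hE i (by simp), neg_mul, mul_assoc,
      ih fun j hj => hE j (by simp [hj]), List.length_cons, pow_succ, mul_smul_comm, mul_assoc,
      mul_neg_one, neg_smul]

theorem word_mul_word_of_anticommute {X : ℕ → Module.End K M} (h : ∀ i j, X i * X j = -(X j * X i))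
    (L L' : List ℕ) :
    word X L * word X L' = (-1 : K) ^ (L.length * L'.length) • (word X L' * word X L) := by
  induction L with
  | nil => simp
  | cons i L ih =>
    rw [word_cons, mul_assoc, ih, mul_smul_comm, ← mul_assoc,
      mul_word_of_anticommute L' fun j _ => h i j, smul_mul_assoc, smul_smul, List.length_cons,
      add_mul, one_mul, pow_add, mul_assoc]

/-- The admitted monomials of parity `p` and multidegree `γ` span this space. -/
def monoSpan (X V : ℕ → Module.End K M) (p : ZMod 2) (γ : Fin 3 → ℤ) :
    Submodule K (Module.End K M) :=
  Submodule.span K {a | ∃ L n, Adm L n ∧ (L.length + 1 : ZMod 2) = p ∧ monoWeight L n = γ ∧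
    a = word X L * V n}

theorem word_mul_mem_monoSpan {X V : ℕ → Module.End K M} {p : ZMod 2} {γ : Fin 3 → ℤ}
    {L : List ℕ} {n : ℕ} (h : Adm L n) (hp : (L.length + 1 : ZMod 2) = p)
    (hγ : monoWeight L n = γ) : word X L * V n ∈ monoSpan X V p γ :=
  Submodule.subset_span ⟨L, n, h, hp, hγ, rfl⟩

theorem v_mem_monoSpan (X V : ℕ → Module.End K M) (n : ℕ) :
    V n ∈ monoSpan X V 1 (pivotWeight n) := by
  have := word_mul_mem_monoSpan (X := X) (V := V) (adm_nil n) rfl rfl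
  simpa [monoWeight] using this

namespace IsPivotSystem

variable {X D V : ℕ → Module.End K M} {e : M} (h : IsPivotSystem X D V e)
include h

theorem x_mul_word_of_mem {i : ℕ} {L : List ℕ} (hi : i ∈ L) : X i * word X L = 0 := by
  induction L with
  | nil => simp at hi
  | cons j L ih =>
    rw [word_cons, ← mul_assoc]
    by_cases hij : i = j
    · rw [hij, h.x_mul_self, zero_mul]
    · rw [h.x_mul_x, neg_mul, mul_assoc, ih ((List.mem_cons.1 hi).resolve_left hij), mul_zero,
        neg_zero]

theorem word_eq_zero {L : List ℕ} (hL : ¬ L.Nodup) : word X L = 0 := by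
  induction L with
  | nil => simp at hL
  | cons i L ih =>
    rw [word_cons]
    by_cases hi : i ∈ L
    · exact h.x_mul_word_of_mem hi
    · rw [ih fun h' => hL (List.nodup_cons.2 ⟨hi, h'⟩), mul_zero]

theorem word_perm {L L' : List ℕ} (hL : L.Perm L') :
    word X L = word X L' ∨ word X L = -word X L' := by
  induction hL with
  | nil => exact Or.inl rfl
  | cons i _ ih =>
    rw [word_cons, word_cons]
    rcases ih with ih | ih <;> simp [ih]
  | swap i j L =>
    refine Or.inr ?_
    rw [word_cons, word_cons, word_cons, word_cons, ← mul_assoc, h.x_mul_x, neg_mul, mul_assoc]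
  | trans _ _ ih₁ ih₂ =>
    rcases ih₁ with h₁ | h₁ <;> rcases ih₂ with h₂ | h₂ <;> simp [h₁, h₂]

/-- Iterating `v_x_anticomm_step` visits `n, n + 3, n + 6, …`. Either `m` is hit, leaving `x_n
x_{n+1} x_{n+3} x_{n+4} ⋯ x_{m-3} x_{m-2}`, or it is jumped over, leaving zero. The number `d`
bounds the remaining steps. -/
theorem v_x_anticomm (m : ℕ) : ∀ d n, m < n + d → V n * X m + X m * V n = 0 ∨
    n ≤ m ∧ ∃ P : List ℕ, (∀ i ∈ P, i + 2 ≤ m) ∧ (P.length : ZMod 2) = 0 ∧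
      (P.map pivotWeight).sum + pivotWeight n = pivotWeight m ∧
      V n * X m + X m * V n = word X P := by
  intro d
  induction d with
  | zero => exact fun n hn => Or.inl (h.v_x_anticomm_of_lt hn)
  | succ d ih =>
    intro n hn
    rcases lt_trichotomy m n with hm | rfl | hm
    · exact Or.inl (h.v_x_anticomm_of_lt hm)
    · exact Or.inr ⟨le_rfl, [], by simp, by simp, by simp, by simp [h.v_x_anticomm_self]⟩
    · rw [h.v_x_anticomm_step, if_neg hm.ne, zero_add]
      rcases ih (n + 3) (by omega) with h0 | ⟨hle, P, hP, hl, hw, h0⟩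
      · exact Or.inl (by rw [h0, mul_zero])
      · refine Or.inr ⟨hm.le, n :: (n + 1) :: P, ?_, ?_, ?_, ?_⟩
        · simp only [List.mem_cons]
          rintro i (rfl | rfl | hi)
          · omega
          · omega
          · exact hP i hi
        · simp only [List.length_cons, Nat.cast_add, Nat.cast_one, hl]; rfl
        · rw [← hw, pivotWeight_add_three]
          simp only [List.map_cons, List.sum_cons]
          module
        · rw [h0, word_cons, word_cons, mul_assoc]

/-- Pairs `x_n x_{n+1}` are peeled off until the two indices differ by at most two, where the
explicit relations apply. The bound `m + 2 ≤ q` leaves room for the letters of both factors in a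
product of admitted monomials. -/
theorem v_v_anticomm (m : ℕ) : ∀ d n, n ≤ m → m < n + d → ∃ (c : K) (E : List ℕ) (q : ℕ),
    m + 2 ≤ q ∧ Adm E q ∧ (E.length : ZMod 2) = 1 ∧
    monoWeight E q = pivotWeight n + pivotWeight m ∧
    V n * V m + V m * V n = c • (word X E * V q) := by
  intro d
  induction d with
  | zero => intro n h1 h2; omega
  | succ d ih =>
    intro n hnm hn
    obtain rfl | rfl | rfl | hm : m = n ∨ m = n + 1 ∨ m = n + 2 ∨ n + 3 ≤ m := by omega
    · refine ⟨2, [m + 1], m + 3, by omega, ?_, by simp, ?_, ?_⟩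
      · simp [Adm]
      · simp only [monoWeight, pivotWeight_add_three, List.map_cons, List.map_nil, List.sum_cons,
          List.sum_nil]
        module
      · rw [h.v_mul_self, two_smul]; simp [word]
    · refine ⟨-1, [n], n + 3, by omega, ?_, by simp, ?_, ?_⟩
      · simp [Adm]
      · simp only [monoWeight, pivotWeight_add_three, List.map_cons, List.map_nil, List.sum_cons,
          List.sum_nil]
        module
      · rw [h.v_anticomm_succ]; simp [word]
    · refine ⟨-1, [n, n + 1, n + 2], n + 5, by omega, ?_, by simp; rfl, ?_, ?_⟩
      · simp [Adm]; omega
      · simp only [monoWeight, pivotWeight_add_three n, pivotWeight_add_three (n + 2),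
          List.map_cons, List.map_nil, List.sum_cons, List.sum_nil]
        module
      · rw [h.v_anticomm_succ_succ]; simp [word, mul_assoc]
    · obtain ⟨c, E, q, hq, hE, hl, hw, h0⟩ := ih (n + 3) hm (by omega)
      refine ⟨c, n :: (n + 1) :: E, q, hq, hE.of_forall_mem ?_, ?_, ?_, ?_⟩
      · simp only [List.mem_cons]
        rintro i (rfl | rfl | hi)
        · omega
        · omega
        · exact Or.inl hi
      · simp only [List.length_cons, Nat.cast_add, Nat.cast_one, hl]; rfl
      · simp only [monoWeight, List.map_cons, List.sum_cons] at hw ⊢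
        rw [pivotWeight_add_three] at hw
        rw [sub_eq_iff_eq_add] at hw ⊢
        rw [hw]
        module
      · rw [h.v_anticomm_step (by omega), h0, word_cons, word_cons, mul_smul_comm]
        simp only [mul_assoc]

/-- The supercommutator of a pivot element with a word. -/
theorem v_word_comm_mem (n : ℕ) (L : List ℕ) :
    V n * word X L - (-1 : K) ^ L.length • (word X L * V n) ∈
      Submodule.span K {a | ∃ P : List ℕ, (∃ j ∈ L, n ≤ j) ∧
        (∀ i ∈ P, i ∈ L ∨ ∃ j ∈ L, i + 2 ≤ j) ∧
        (P.length + 1 : ZMod 2) = L.length ∧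
        (P.map pivotWeight).sum + pivotWeight n = (L.map pivotWeight).sum ∧ a = word X P} := by
  induction L with
  | nil => simp
  | cons m L ih =>
    have e : V n * word X (m :: L) - (-1 : K) ^ (m :: L).length • (word X (m :: L) * V n) =
        (V n * X m + X m * V n) * word X L -
          X m * (V n * word X L - (-1 : K) ^ L.length • (word X L * V n)) := by
      rw [word_cons, List.length_cons, pow_succ, mul_neg_one, neg_smul, mul_sub, mul_smul_comm,
        add_mul]
      simp only [mul_assoc]
      abel
    rw [e]
    refine Submodule.sub_mem _ ?_ ?_
    · rcases h.v_x_anticomm m (m + 1) n (by omega) with h0 | ⟨hnm, P, hP, hl, hw, h0⟩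
      · rw [h0, zero_mul]; exact Submodule.zero_mem _
      · rw [h0, ← word_append]
        refine Submodule.subset_span ⟨P ++ L, ⟨m, by simp, hnm⟩, ?_, ?_, ?_, rfl⟩
        · intro i hi
          rcases List.mem_append.1 hi with hi | hi
          · exact Or.inr ⟨m, by simp, hP i hi⟩
          · exact Or.inl (by simp [hi])
        · simp [hl]
        · rw [List.map_append, List.sum_append, List.map_cons, List.sum_cons, ← hw]
          abel
    · have key : ∀ a ∈ Submodule.span K {a | ∃ P : List ℕ, (∃ j ∈ L, n ≤ j) ∧
          (∀ i ∈ P, i ∈ L ∨ ∃ j ∈ L, i + 2 ≤ j) ∧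
          (P.length + 1 : ZMod 2) = L.length ∧
          (P.map pivotWeight).sum + pivotWeight n = (L.map pivotWeight).sum ∧ a = word X P},
          X m * a ∈ Submodule.span K {a | ∃ P : List ℕ, (∃ j ∈ m :: L, n ≤ j) ∧
            (∀ i ∈ P, i ∈ m :: L ∨ ∃ j ∈ m :: L, i + 2 ≤ j) ∧
            (P.length + 1 : ZMod 2) = (m :: L).length ∧
            (P.map pivotWeight).sum + pivotWeight n = ((m :: L).map pivotWeight).sum ∧
            a = word X P} := by
        intro a ha
        induction ha using Submodule.span_induction with
        | mem a ha =>
          obtain ⟨P, ⟨j, hj, hnj⟩, hP, hl, hw, rfl⟩ := ha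
          refine Submodule.subset_span ⟨m :: P, ⟨j, by simp [hj], hnj⟩, ?_, ?_, ?_,
            (word_cons _ _ _).symm⟩
          · intro i hi
            rcases List.mem_cons.1 hi with rfl | hi
            · exact Or.inl (by simp)
            · rcases hP i hi with h1 | ⟨j, hj, h1⟩
              · exact Or.inl (by simp [h1])
              · exact Or.inr ⟨j, by simp [hj], h1⟩
          · simp [hl]
          · rw [List.map_cons, List.sum_cons, List.map_cons, List.sum_cons, ← hw]
            abel
        | zero => rw [mul_zero]; exact Submodule.zero_mem _
        | add a b _ _ ha hb => rw [mul_add]; exact Submodule.add_mem _ ha hb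
        | smul c a _ ha => rw [mul_smul_comm]; exact Submodule.smul_mem _ c ha
      exact key _ ih

/-- This is the super Leibniz rule with one term missing: the letters of `L` lie below `n ≤ m`, so
`V m` passes them with only a sign. -/
theorem sbr_word_mul_v_eq {L L' : List ℕ} {n m : ℕ} (hnm : n ≤ m) (hL : Adm L n) :
    sbr ((L.length + 1 : ℕ) : ZMod 2) ((L'.length + 1 : ℕ) : ZMod 2) (word X L * V n)
      (word X L' * V m) =
    word X L * (V n * word X L' - (-1 : K) ^ L'.length • (word X L' * V n)) * V m +
      (-1 : K) ^ L'.length • (word X L * word X L' * (V n * V m + V m * V n)) := by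
  have h1 : V m * word X L = (-1 : K) ^ L.length • (word X L * V m) :=
    mul_word_of_anticommute L fun i hi => h.v_mul_x (by have := hL.1 i hi; omega)
  have h2 := word_mul_word_of_anticommute h.x_mul_x L' L
  have h3 : word X L' * V m * (word X L * V n) = ((-1 : K) ^ L.length *
      (-1 : K) ^ (L'.length * L.length)) • (word X L * word X L' * (V m * V n)) := by
    rw [mul_assoc, ← mul_assoc (V m), h1, smul_mul_assoc, mul_smul_comm, mul_assoc (word X L),
      ← mul_assoc (word X L'), h2, smul_mul_assoc, smul_smul]
  have h4 : (-1 : K) ^ ((L.length + 1) * (L'.length + 1)) * ((-1 : K) ^ L.length *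
      (-1 : K) ^ (L'.length * L.length)) = -(-1 : K) ^ L'.length := by
    rw [← pow_add, ← pow_add, show (L.length + 1) * (L'.length + 1) + (L.length + L'.length *
      L.length) = 2 * (L.length * L'.length + L.length) + (L'.length + 1) by ring, pow_add,
      pow_mul, neg_one_sq, one_pow, one_mul, pow_succ, mul_neg_one]
  rw [sbr, neg_one_pow_zmod_val, h3, smul_smul, h4, mul_add, smul_add, mul_sub, sub_mul,
    mul_smul_comm, smul_mul_assoc, neg_smul, sub_neg_eq_add]
  simp only [mul_assoc]
  abel

theorem sbr_word_mul_v_mem {L L' : List ℕ} {n m : ℕ} (hnm : n ≤ m) (hL : Adm L n)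
    (hL' : Adm L' m) :
    sbr ((L.length + 1 : ℕ) : ZMod 2) ((L'.length + 1 : ℕ) : ZMod 2) (word X L * V n)
      (word X L' * V m) ∈ monoSpan X V (((L.length + 1 : ℕ) : ZMod 2) +
        ((L'.length + 1 : ℕ) : ZMod 2)) (monoWeight L n + monoWeight L' m) := by
  rw [h.sbr_word_mul_v_eq hnm hL]
  refine Submodule.add_mem _ ?_ (Submodule.smul_mem _ _ ?_)
  · have hmem := h.v_word_comm_mem n L'
    generalize V n * word X L' - (-1 : K) ^ L'.length • (word X L' * V n) = a at hmem
    induction hmem using Submodule.span_induction with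
    | mem a ha =>
      obtain ⟨P, ⟨j, hj, hnj⟩, hP, hl, hw, rfl⟩ := ha
      rw [← word_append]
      refine word_mul_mem_monoSpan ?_ ?_ ?_
      -- The pivot `V n` hits a letter `j` with `n ≤ j ≤ m - 2`. Hence the letters of `L` are at
      -- most `m - 4`, and so are the new letters, which are at most `k - 2` for some `k` in `L'`.
      · have hjm := hL'.1 j hj
        refine hL'.of_forall_mem fun i hi => ?_
        rcases List.mem_append.1 hi with hi | hi
        · have := hL.1 i hi
          exact Or.inr (by omega)
        · refine (hP i hi).imp_right fun ⟨k, hk, hik⟩ => ?_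
          have := hL'.1 k hk
          omega
      · push_cast
        rw [List.length_append, Nat.cast_add, ← hl]
        have h2 : (2 : ZMod 2) = 0 := rfl
        linear_combination -h2
      · rw [monoWeight, monoWeight, monoWeight, List.map_append, List.sum_append, ← hw]
        abel
    | zero => rw [mul_zero, zero_mul]; exact Submodule.zero_mem _
    | add a b _ _ ha hb => rw [mul_add, add_mul]; exact Submodule.add_mem _ ha hb
    | smul c a _ ha => rw [mul_smul_comm, smul_mul_assoc]; exact Submodule.smul_mem _ c ha
  · obtain ⟨c, E, q, hq, hE, hl, hw, h0⟩ := h.v_v_anticomm m (m + 1) n hnm (by omega)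
    rw [h0, mul_smul_comm, ← mul_assoc, ← word_append, ← word_append]
    refine Submodule.smul_mem _ _ (word_mul_mem_monoSpan (hE.of_forall_mem fun i hi => ?_) ?_ ?_)
    -- All letters of `L` and `L'` are at most `m - 2 ≤ q - 4`, so only the letters of `E` could
    -- violate admission at `q`.
    · rcases List.mem_append.1 hi with hi | hi
      · rcases List.mem_append.1 hi with hi | hi
        · have := hL.1 i hi
          exact Or.inr (by omega)
        · have := hL'.1 i hi
          exact Or.inr (by omega)
      · exact Or.inl hi
    · simp only [List.length_append]
      push_cast
      rw [hl]
      ring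
    · rw [monoWeight] at hw ⊢
      rw [List.map_append, List.sum_append, List.map_append, List.sum_append, monoWeight,
        monoWeight, add_comm, ← sub_sub, hw]
      abel

theorem sbr_mem_monoSpan {p q : ZMod 2} {γ δ : Fin 3 → ℤ} {a b : Module.End K M}
    (ha : a ∈ monoSpan X V p γ) (hb : b ∈ monoSpan X V q δ) :
    sbr p q a b ∈ monoSpan X V (p + q) (γ + δ) := by
  induction ha, hb using Submodule.span_induction₂ with
  | mem_mem a b ha hb =>
    obtain ⟨L, n, hL, rfl, rfl, rfl⟩ := ha
    obtain ⟨L', m, hL', rfl, rfl, rfl⟩ := hb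
    rcases le_total n m with hnm | hnm
    · exact_mod_cast h.sbr_word_mul_v_mem hnm hL hL'
    · rw [sbr_swap, add_comm (L.length + 1 : ZMod 2), add_comm (monoWeight L n)]
      refine Submodule.neg_mem _ (Submodule.smul_mem _ _ ?_)
      exact_mod_cast h.sbr_word_mul_v_mem hnm hL' hL
  | zero_left b _ => simp [sbr]
  | zero_right a _ => simp [sbr]
  | add_left a b c _ _ _ ha hb =>
    rw [show sbr p q (a + b) c = sbr p q a c + sbr p q b c by
      simp only [sbr, add_mul, mul_add, smul_add]; abel]
    exact Submodule.add_mem _ ha hb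
  | add_right a b c _ _ _ ha hb =>
    rw [show sbr p q a (b + c) = sbr p q a b + sbr p q a c by
      simp only [sbr, add_mul, mul_add, smul_add]; abel]
    exact Submodule.add_mem _ ha hb
  | smul_left r a b _ _ ha =>
    rw [show sbr p q (r • a) b = r • sbr p q a b by
      simp only [sbr, smul_mul_assoc, mul_smul_comm, smul_sub, smul_comm r]]
    exact Submodule.smul_mem _ _ ha
  | smul_right r a b _ _ ha =>
    rw [show sbr p q a (r • b) = r • sbr p q a b by
      simp only [sbr, smul_mul_assoc, mul_smul_comm, smul_sub, smul_comm r]]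
    exact Submodule.smul_mem _ _ ha

/-- Moving `V n` past the second word leaves two copies of that word and `V n * V n`. Repeated
letters are harmless: such a word is zero but still formally admitted. The only letter that is not
below `n` is `n + 1`, so the critical pair `n`, `n + 1` of `V (n + 3)` does not occur. -/
theorem mul_self_word_mul_v_mem {L : List ℕ} {n : ℕ} (hL : Adm L n)
    (hp : (L.length + 1 : ZMod 2) = 1) :
    word X L * V n * (word X L * V n) ∈
      monoSpan X V 0 (monoWeight L n + monoWeight L n) := by
  have h1 : V n * word X L = (-1 : K) ^ L.length • (word X L * V n) :=
    mul_word_of_anticommute L fun i hi => h.v_mul_x (by have := hL.1 i hi; omega)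
  have e : word X L * V n * (word X L * V n) =
      (-1 : K) ^ L.length • (word X (L ++ (L ++ [n + 1])) * V (n + 3)) := by
    rw [mul_assoc, ← mul_assoc (V n), h1, word_append, word_append, smul_mul_assoc,
      mul_assoc _ (V n), h.v_mul_self, mul_smul_comm]
    simp [word, mul_assoc]
  rw [e]
  refine Submodule.smul_mem _ _ (word_mul_mem_monoSpan ?_ ?_ ?_)
  · refine ⟨fun i hi => ?_, fun k hk h1 _ => ?_⟩
    · simp only [List.mem_append, List.mem_singleton] at hi
      rcases hi with hi | hi | rfl
      · have := hL.1 i hi; omega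
      · have := hL.1 i hi; omega
      · omega
    · simp only [List.mem_append, List.mem_singleton] at h1
      rcases h1 with hi | hi | rfl
      · have := hL.1 k hi; omega
      · have := hL.1 k hi; omega
      · omega
  · simp only [List.length_append, List.length_singleton]
    push_cast
    have h2 : (2 : ZMod 2) = 0 := rfl
    linear_combination 2 * hp + h2
  · simp only [monoWeight, pivotWeight_add_three, List.map_append, List.sum_append, List.map_cons,
      List.map_nil, List.sum_cons, List.sum_nil]
    module

/-- A space of admitted monomials of given multidegree is at most one-dimensional. -/
theorem exists_monoSpan_le (p : ZMod 2) (γ : Fin 3 → ℤ) :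
    ∃ a, monoSpan X V p γ ≤ Submodule.span K {a} := by
  by_cases hex : ∃ L n, Adm L n ∧ L.Nodup ∧ monoWeight L n = γ
  · obtain ⟨L, n, hL, hn, rfl⟩ := hex
    refine ⟨word X L * V n, Submodule.span_le.2 ?_⟩
    rintro _ ⟨L', m, hL', -, hw, rfl⟩
    by_cases hn' : L'.Nodup
    · obtain ⟨rfl, hperm⟩ := hL'.eq_of_monoWeight_eq hn' hL hn hw
      rcases h.word_perm hperm with e | e
      · rw [e]; exact Submodule.mem_span_singleton_self _
      · rw [e, neg_mul]
        exact Submodule.neg_mem _ (Submodule.mem_span_singleton_self _)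
    · rw [h.word_eq_zero hn', zero_mul]; exact Submodule.zero_mem _
  · refine ⟨0, Submodule.span_le.2 ?_⟩
    rintro _ ⟨L', m, hL', -, hw, rfl⟩
    rw [h.word_eq_zero fun hn' => hex ⟨L', m, hL', hn', hw⟩, zero_mul]
    exact Submodule.zero_mem _

end IsPivotSystem

end Words

/-! ### Filtrations of the Grassmann algebra and nilpotency of even elements -/

section Nilpotency

variable {K : Type*} [Field K] {M : Type*} [AddCommGroup M] [Module K M]

/-- The span of the words without repeated letters whose `u`-degree is at least `d`. -/
def ordSpan (X : ℕ → Module.End K M) (e : M) (u : ℕ → ℤ) (d : ℤ) : Submodule K M :=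
  Submodule.span K {f | ∃ L : List ℕ, L.Nodup ∧ d ≤ (L.map u).sum ∧ f = word X L e}

/-- The operator `φ` raises the `u`-degree by at least `c`. -/
def HasOrder (X : ℕ → Module.End K M) (e : M) (u : ℕ → ℤ) (c : ℤ) (φ : Module.End K M) : Prop :=
  ∀ d, ∀ f ∈ ordSpan X e u d, φ f ∈ ordSpan X e u (d + c)

variable {X D V : ℕ → Module.End K M} {e : M} {u : ℕ → ℤ}

theorem ordSpan_antitone {d d' : ℤ} (hd : d ≤ d') : ordSpan X e u d' ≤ ordSpan X e u d :=
  Submodule.span_mono fun _ ⟨L, hL, h, hf⟩ => ⟨L, hL, hd.trans h, hf⟩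

namespace HasOrder

theorem mono {c c' : ℤ} {φ : Module.End K M} (h : HasOrder X e u c φ) (hc : c' ≤ c) :
    HasOrder X e u c' φ :=
  fun d f hf => ordSpan_antitone (by omega) (h d f hf)

theorem zero (c : ℤ) : HasOrder X e u c 0 := fun _ _ _ => Submodule.zero_mem _

theorem one : HasOrder X e u 0 1 := fun d f hf => by rwa [add_zero]

theorem add {c : ℤ} {φ ψ : Module.End K M} (h : HasOrder X e u c φ) (h' : HasOrder X e u c ψ) :
    HasOrder X e u c (φ + ψ) :=
  fun d f hf => Submodule.add_mem _ (h d f hf) (h' d f hf)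

theorem smul {c : ℤ} {φ : Module.End K M} (h : HasOrder X e u c φ) (r : K) :
    HasOrder X e u c (r • φ) :=
  fun d f hf => Submodule.smul_mem _ r (h d f hf)

theorem mul {c c' : ℤ} {φ ψ : Module.End K M} (h : HasOrder X e u c φ)
    (h' : HasOrder X e u c' ψ) : HasOrder X e u (c + c') (φ * ψ) :=
  fun d f hf => by
    rw [add_comm c, ← add_assoc]
    exact h _ _ (h' d f hf)

theorem pow {φ : Module.End K M} {c : ℤ} (h : HasOrder X e u c φ) (k : ℕ) :
    HasOrder X e u (k * c) (φ ^ k) := by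
  induction k with
  | zero => simpa using one
  | succ k ih =>
    rw [pow_succ, Nat.cast_succ, add_mul, one_mul]
    exact ih.mul h

theorem of_word {c : ℤ} {φ : Module.End K M}
    (h : ∀ L : List ℕ, L.Nodup → φ (word X L e) ∈ ordSpan X e u ((L.map u).sum + c)) :
    HasOrder X e u c φ := by
  intro d f hf
  induction hf using Submodule.span_induction with
  | mem f hf =>
    obtain ⟨L, hL, hd, rfl⟩ := hf
    exact ordSpan_antitone (by omega) (h L hL)
  | zero => rw [map_zero]; exact Submodule.zero_mem _
  | add f g _ _ hf hg => rw [map_add]; exact Submodule.add_mem _ hf hg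
  | smul r f _ hf => rw [map_smul]; exact Submodule.smul_mem _ r hf

end HasOrder

theorem word_mem_ordSpan {L : List ℕ} (hL : L.Nodup) {d : ℤ} (hd : d ≤ (L.map u).sum) :
    word X L e ∈ ordSpan X e u d := Submodule.subset_span ⟨L, hL, hd, rfl⟩

theorem abs_sum_map_le {N : ℕ} (hu : ∀ i, N ≤ i → u i = 0) {L : List ℕ} (hL : L.Nodup) :
    |(L.map u).sum| ≤ ∑ i ∈ Finset.range N, |u i| := by
  rw [← List.sum_toFinset _ hL]
  calc |∑ i ∈ L.toFinset, u i| ≤ ∑ i ∈ L.toFinset, |u i| := Finset.abs_sum_le_sum_abs _ _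
    _ = ∑ i ∈ L.toFinset ∩ Finset.range N, |u i| := by
      refine (Finset.sum_subset Finset.inter_subset_left fun i hi hi' => ?_).symm
      rw [hu i (by simpa [List.mem_toFinset.1 hi] using hi'), abs_zero]
    _ ≤ _ := Finset.sum_le_sum_of_subset_of_nonneg Finset.inter_subset_right
      fun i _ _ => abs_nonneg _

/-- A word without repetitions has degree bounded by the sum of the finitely many nonzero `|u i|`.
-/
theorem ordSpan_eq_bot {N : ℕ} (hu : ∀ i, N ≤ i → u i = 0) {d : ℤ}
    (hd : ∑ i ∈ Finset.range N, |u i| < d) : ordSpan X e u d = ⊥ := by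
  refine Submodule.span_eq_bot.2 ?_
  rintro _ ⟨L, hL, hd', rfl⟩
  have := (le_abs_self _).trans (abs_sum_map_le hu hL)
  omega

namespace IsPivotSystem

variable (h : IsPivotSystem X D V e)
include h

theorem hasOrder_x (u : ℕ → ℤ) (i : ℕ) : HasOrder X e u (u i) (X i) := by
  refine HasOrder.of_word fun L hL => ?_
  rw [← Module.End.mul_apply, ← word_cons]
  by_cases hi : i ∈ L
  · rw [h.word_eq_zero fun h' => (List.nodup_cons.1 h').1 hi]
    exact Submodule.zero_mem _
  · exact word_mem_ordSpan (List.nodup_cons.2 ⟨hi, hL⟩) (by simp [add_comm])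

theorem d_word_of_notMem {i : ℕ} {L : List ℕ} (hi : i ∉ L) : D i (word X L e) = 0 := by
  have hD : ∀ j ∈ L, D i * X j = -(X j * D i) := fun j hj =>
    h.d_mul_x_of_ne fun hij => hi (hij ▸ hj)
  rw [← Module.End.mul_apply, mul_word_of_anticommute L hD, LinearMap.smul_apply,
    Module.End.mul_apply, h.d_vacuum, map_zero, smul_zero]

theorem d_word_cons {i : ℕ} {L : List ℕ} (hi : i ∉ L) : D i (word X (i :: L) e) = word X L e := by
  rw [word_cons, ← Module.End.mul_apply, ← mul_assoc, h.d_mul_x, if_pos rfl, sub_mul, one_mul,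
    LinearMap.sub_apply, mul_assoc, Module.End.mul_apply, Module.End.mul_apply,
    h.d_word_of_notMem hi, map_zero, sub_zero]

theorem hasOrder_d (u : ℕ → ℤ) (i : ℕ) : HasOrder X e u (-u i) (D i) := by
  refine HasOrder.of_word fun L hL => ?_
  by_cases hi : i ∈ L
  · have hp := List.perm_cons_erase hi
    have hmem : word X (L.erase i) e ∈ ordSpan X e u ((L.map u).sum + -u i) :=
      word_mem_ordSpan (hL.erase i) (by rw [(hp.map u).sum_eq]; simp)
    have hni : i ∉ L.erase i := hL.not_mem_erase
    rcases h.word_perm hp with h0 | h0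
    · rwa [h0, h.d_word_cons hni]
    · rw [h0, LinearMap.neg_apply, map_neg, h.d_word_cons hni]
      exact Submodule.neg_mem _ hmem
  · rw [h.d_word_of_notMem hi]
    exact Submodule.zero_mem _

theorem hasOrder_word (u : ℕ → ℤ) (L : List ℕ) : HasOrder X e u (L.map u).sum (word X L) := by
  induction L with
  | nil => exact HasOrder.one
  | cons i L ih =>
    rw [word_cons, List.map_cons, List.sum_cons]
    exact (h.hasOrder_x u i).mul ih

/-- All letters and derivations in `V n` have index at least `N` and so degree zero; the infinite
sum is again tested on one vector. -/
theorem hasOrder_v {N : ℕ} (hu : ∀ i, N ≤ i → u i = 0) {n : ℕ} (hn : N ≤ n) :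
    HasOrder X e u 0 (V n) := by
  intro d f hf
  rw [add_zero]
  obtain ⟨N', hN'⟩ := h.v_eventually f
  suffices ∀ k m, N ≤ m → N' ≤ m + k → V m f ∈ ordSpan X e u d from this N' n hn (by omega)
  intro k
  induction k with
  | zero => exact fun m _ hm => by rw [hN' m hm]; exact Submodule.zero_mem _
  | succ k ih =>
    intro m hm hk
    rw [h.v_eq]
    refine Submodule.add_mem _ ?_ ?_
    · simpa [hu m hm] using h.hasOrder_d u m d f hf
    · simpa [hu m hm, hu (m + 1) (by omega)] using
        ((h.hasOrder_x u m).mul (h.hasOrder_x u (m + 1))) d _ (ih (m + 3) (by omega) (by omega))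

theorem ordSpan_eq_top {N : ℕ} (hu : ∀ i, N ≤ i → u i = 0) {d : ℤ}
    (hd : d ≤ -∑ i ∈ Finset.range N, |u i|) : ordSpan X e u d = ⊤ := by
  rw [eq_top_iff, ← h.span_word]
  refine Submodule.span_le.2 ?_
  rintro _ ⟨L, rfl⟩
  by_cases hL : L.Nodup
  · have := (neg_le_abs _).trans (abs_sum_map_le hu hL)
    exact word_mem_ordSpan hL (by omega)
  · simp only [h.word_eq_zero hL, LinearMap.zero_apply]
    exact Submodule.zero_mem _

theorem isNilpotent_of_hasOrder {N : ℕ} (hu : ∀ i, N ≤ i → u i = 0) {φ : Module.End K M}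
    (hφ : HasOrder X e u 1 φ) : IsNilpotent φ := by
  set B := ∑ i ∈ Finset.range N, |u i|
  have hB : 0 ≤ B := Finset.sum_nonneg fun _ _ => abs_nonneg _
  -- Degrees lie between `-B` and `B`, so raising the degree `2 * B + 1` times leaves nothing.
  refine ⟨(2 * B + 1).toNat, LinearMap.ext fun f => ?_⟩
  have h1 := hφ.pow (2 * B + 1).toNat (-B) f (by
    rw [h.ordSpan_eq_top hu le_rfl]; exact Submodule.mem_top)
  rw [ordSpan_eq_bot hu (by rw [Int.toNat_of_nonneg (by omega)]; omega)] at h1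
  exact h1

/-- A pivot element splits into its summands with `∂_i`, `i < N`, which raise the weight in the
letters `x_i`, `i < N`, and the other summands, which do not lower the degree in these letters. -/
theorem exists_v_eq_add (N : ℕ) : ∀ k n, N ≤ n + k → ∃ S B, V n = S + B ∧
    HasOrder X e (fun i => if i < N then 1 else 0) (-1) S ∧
    HasOrder X e (fun i => if i < N then -(height i : ℤ) else 0) (height n) S ∧
    HasOrder X e (fun i => if i < N then 1 else 0) 0 B := by
  have hle : ∀ n, N ≤ n → ∃ S B, V n = S + B ∧
      HasOrder X e (fun i => if i < N then 1 else 0) (-1) S ∧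
      HasOrder X e (fun i => if i < N then -(height i : ℤ) else 0) (height n) S ∧
      HasOrder X e (fun i => if i < N then 1 else 0) 0 B := fun n hn =>
    ⟨0, V n, (zero_add _).symm, HasOrder.zero _, HasOrder.zero _,
      h.hasOrder_v (N := N) (fun i hi => if_neg (by omega)) hn⟩
  intro k
  induction k with
  | zero => exact hle
  | succ k ih =>
    intro n hn
    rcases le_or_gt N n with hN | hN
    · exact hle n hN
    obtain ⟨S, B, hV, h1, h2, h3⟩ := ih (n + 3) (by omega)
    have hd := h.hasOrder_d (fun i => if i < N then (1 : ℤ) else 0) n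
    have hd' := h.hasOrder_d (fun i => if i < N then -(height i : ℤ) else 0) n
    have hx := h.hasOrder_x (fun i => if i < N then (1 : ℤ) else 0)
    have hx' := h.hasOrder_x (fun i => if i < N then -(height i : ℤ) else 0)
    have hx0 : ∀ i, HasOrder X e (fun i => if i < N then (1 : ℤ) else 0) 0 (X i) :=
      fun i => (hx i).mono (by split_ifs <;> omega)
    have hx0' : ∀ i, HasOrder X e (fun i => if i < N then -(height i : ℤ) else 0) (-height i)
      (X i) := fun i => (hx' i).mono (by split_ifs <;> omega)
    -- As `n < N`, the new derivation belongs to `S`; the prefix multiplies both parts of the tail.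
    refine ⟨D n + X n * X (n + 1) * S, X n * X (n + 1) * B, ?_, ?_, ?_, ?_⟩
    · rw [h.v_eq n, hV]; noncomm_ring
    · exact (hd.mono (by simp [hN])).add ((((hx0 n).mul (hx0 (n + 1))).mul h1).mono (by omega))
    -- All summands have the same height, since `height (n + 3) - height n - height (n + 1) = height
    -- n`.
    · refine (hd'.mono (by simp [hN])).add ((((hx0' n).mul (hx0' (n + 1))).mul h2).mono ?_)
      have := height_add_three n
      omega
    · exact (((hx0 n).mul (hx0 (n + 1))).mul h3).mono (by omega)

/-- For large `N`, an even element splits into an operator that raises the weight in the letters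
`x_i`, `i < N`, and does not lower the degree, and an operator that raises the degree. -/
theorem exists_eq_add_of_even {a : Module.End K M} (ha : a ∈ ⨆ γ, monoSpan X V 0 γ) :
    ∃ N₀, ∀ N, N₀ ≤ N → ∃ S B, a = S + B ∧
      HasOrder X e (fun i => if i < N then 1 else 0) 0 S ∧
      HasOrder X e (fun i => if i < N then -(height i : ℤ) else 0) 1 S ∧
      HasOrder X e (fun i => if i < N then 1 else 0) 1 B := by
  simp only [monoSpan, Submodule.iSup_span] at ha
  induction ha using Submodule.span_induction with
  | mem a ha =>
    obtain ⟨γ, L, n, hL, hp, -, rfl⟩ := Set.mem_iUnion.1 ha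
    -- For `N ≥ n` every letter of `L` lies below `N` and counts fully in both degrees.
    refine ⟨n, fun N hN => ?_⟩
    by_cases hn : L.Nodup
    · obtain ⟨S, B, hV, h1, h2, h3⟩ := h.exists_v_eq_add N N n (by omega)
      have hlt : ∀ i ∈ L, i < N := fun i hi => by have := hL.1 i hi; omega
      have e1 : (L.map fun i => if i < N then (1 : ℤ) else 0).sum = L.length := by
        rw [List.map_congr_left (g := fun _ => (1 : ℤ)) fun i hi => if_pos (hlt i hi)]
        simp
      have e2 : (L.map fun i => if i < N then -(height i : ℤ) else 0).sum =
          -((L.map height).sum : ℕ) := by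
        rw [List.map_congr_left (g := fun i => -(height i : ℤ)) fun i hi => if_pos (hlt i hi)]
        clear hL hp hn hlt e1 ha
        induction L with
        | nil => simp
        | cons i L ih => simp [ih]; ring
      have hw := h.hasOrder_word (fun i => if i < N then (1 : ℤ) else 0) L
      have hw' := h.hasOrder_word (fun i => if i < N then -(height i : ℤ) else 0) L
      rw [e1] at hw
      rw [e2] at hw'
      -- An even monomial has an odd number of letters. One letter compensates the `-1` of the
      -- derivation in `S` and makes the other part raise the degree.
      have hpos : 0 < L.length := List.length_pos_iff.2 fun h0 => by
        subst h0; simp at hp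
      have hlt := hL.sum_height_lt hn
      refine ⟨word X L * S, word X L * B, by rw [hV, mul_add], (hw.mul h1).mono (by omega),
        (hw'.mul h2).mono (by omega), (hw.mul h3).mono (by omega)⟩
    · exact ⟨0, 0, by rw [h.word_eq_zero hn, zero_mul, add_zero], HasOrder.zero _,
        HasOrder.zero _, HasOrder.zero _⟩
  | zero => exact ⟨0, fun N _ => ⟨0, 0, (add_zero _).symm, HasOrder.zero _,
      HasOrder.zero _, HasOrder.zero _⟩⟩
  | add a b _ _ ha hb =>
    obtain ⟨N₁, h₁⟩ := ha
    obtain ⟨N₂, h₂⟩ := hb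
    refine ⟨max N₁ N₂, fun N hN => ?_⟩
    obtain ⟨S₁, B₁, e₁, i₁, j₁, k₁⟩ := h₁ N ((le_max_left _ _).trans hN)
    obtain ⟨S₂, B₂, e₂, i₂, j₂, k₂⟩ := h₂ N ((le_max_right _ _).trans hN)
    exact ⟨S₁ + S₂, B₁ + B₂, by rw [e₁, e₂]; abel, i₁.add i₂, j₁.add j₂, k₁.add k₂⟩
  | smul r a _ ha =>
    obtain ⟨N₁, h₁⟩ := ha
    refine ⟨N₁, fun N hN => ?_⟩
    obtain ⟨S₁, B₁, e₁, i₁, j₁, k₁⟩ := h₁ N hN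
    exact ⟨r • S₁, r • B₁, by rw [e₁, smul_add], i₁.smul r, j₁.smul r, k₁.smul r⟩

/-- Modulo operators that raise the degree, powers of `S + B` agree with those of `S`, and `S` is
nilpotent because it raises a bounded weight. -/
theorem isNilpotent_of_even {a : Module.End K M} (ha : a ∈ ⨆ γ, monoSpan X V 0 γ) :
    IsNilpotent a := by
  obtain ⟨N, hN⟩ := h.exists_eq_add_of_even ha
  obtain ⟨S, B, rfl, h1, h2, h3⟩ := hN N le_rfl
  obtain ⟨P, hP⟩ := h.isNilpotent_of_hasOrder (N := N) (fun i hi => if_neg (by omega)) h2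
  have hS : ∀ k, HasOrder X e (fun i => if i < N then 1 else 0) 0 (S ^ k) :=
    fun k => by simpa using h1.pow k
  have key : ∀ k, HasOrder X e (fun i => if i < N then 1 else 0) 1 ((S + B) ^ k - S ^ k) := by
    intro k
    induction k with
    | zero =>
      rw [pow_zero, pow_zero, sub_self]
      exact HasOrder.zero 1
    | succ k ih =>
      rw [show (S + B) ^ (k + 1) - S ^ (k + 1) = (S + B) * ((S + B) ^ k - S ^ k) + B * S ^ k by
        rw [pow_succ', pow_succ']; noncomm_ring]
      exact (((h1.add (h3.mono zero_le_one)).mul ih).mono (zero_add 1).ge).add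
        ((h3.mul (hS k)).mono (add_zero 1).ge)
  have hfin := key P
  rw [hP, sub_zero] at hfin
  exact (h.isNilpotent_of_hasOrder (N := N) (fun i hi => if_neg (by omega)) hfin).of_pow

end IsPivotSystem

end Nilpotency

/-! ### The operators on the Grassmann algebra -/

section Concrete

theorem zmod_two_cases : ∀ j : ZMod 2, j = 0 ∨ j = 1 := by decide

theorem zmod_two_sum {A : Type*} [AddCommMonoid A] (g : ZMod 2 → A) : ∑ j, g j = g 0 + g 1 :=
  Fin.sum_univ_two g

variable (K : Type*) [Field K]

theorem pivot_apply (n : ℕ) (f : Gr K) : pivot K n f = ∑ᶠ k, pivotTerm K n k f := rfl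

theorem pivot_eq (n : ℕ) :
    pivot K n = dop K n + xop K n * xop K (n + 1) * pivot K (n + 3) := by
  refine LinearMap.ext fun f => ?_
  obtain ⟨B, hB⟩ := (pivotTerm_finite K n f).bddAbove
  obtain ⟨C, hC⟩ := (pivotTerm_finite K (n + 3) f).bddAbove
  have h1 : (Function.support fun k => pivotTerm K n k f) ⊆
      ↑(Finset.range (max B C + 1 + 1)) := fun k hk => by
    have := hB hk
    have := le_max_left B C
    simp only [Finset.coe_range, Set.mem_Iio]; omega
  have h2 : (Function.support fun k => pivotTerm K (n + 3) k f) ⊆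
      ↑(Finset.range (max B C + 1)) := fun k hk => by
    have := hC hk
    have := le_max_right B C
    simp only [Finset.coe_range, Set.mem_Iio]; omega
  rw [LinearMap.add_apply, Module.End.mul_apply, pivot_apply, pivot_apply,
    finsum_eq_sum_of_support_subset _ h1, finsum_eq_sum_of_support_subset _ h2,
    Finset.sum_range_succ', map_sum, add_comm]
  rfl

theorem pivot_eventually (f : Gr K) : ∃ N, ∀ n, N ≤ n → pivot K n f = 0 := by
  obtain ⟨B, hB⟩ := (dop_finite K f).bddAbove
  refine ⟨B + 1, fun n hn => ?_⟩
  rw [pivot_apply]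
  refine finsum_eq_zero_of_forall_eq_zero fun k => pivotTerm_eq_zero K f k n ?_
  by_contra h0
  have : n + 3 * k ≤ B := hB h0
  omega

theorem span_word_one :
    Submodule.span K (Set.range fun L => word (xop K) L (1 : Gr K)) = ⊤ := by
  have hadd : ∀ m : ℕ →₀ K, ∀ a ∈ Submodule.span K (Set.range fun L => word (xop K) L (1 : Gr K)),
      ExteriorAlgebra.ι K m * a ∈
        Submodule.span K (Set.range fun L => word (xop K) L (1 : Gr K)) := by
    intro m a ha
    induction ha using Submodule.span_induction with
    | mem a ha =>
      obtain ⟨L, rfl⟩ := ha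
      induction m using Finsupp.induction_linear with
      | zero => simp
      | add m n hm hn => rw [map_add, add_mul]; exact Submodule.add_mem _ hm hn
      | single i c =>
        rw [← Finsupp.smul_single_one, map_smul, smul_mul_assoc]
        refine Submodule.smul_mem _ _ (Submodule.subset_span ⟨i :: L, ?_⟩)
        simp only [word_cons]
        rfl
    | zero => rw [mul_zero]; exact Submodule.zero_mem _
    | add a b _ _ ha hb => rw [mul_add]; exact Submodule.add_mem _ ha hb
    | smul c a _ ha => rw [mul_smul_comm]; exact Submodule.smul_mem _ c ha
  rw [eq_top_iff]
  intro f _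
  induction f using CliffordAlgebra.left_induction with
  | algebraMap r =>
    rw [Algebra.algebraMap_eq_smul_one]
    exact Submodule.smul_mem _ r (Submodule.subset_span ⟨[], rfl⟩)
  | add a b ha hb => exact Submodule.add_mem _ (ha trivial) (hb trivial)
  | ι_mul a m ha => exact hadd m a (ha trivial)

theorem isPivotSystem : IsPivotSystem (xop K) (dop K) (pivot K) (1 : Gr K) where
  x_mul_self i := by
    refine LinearMap.ext fun f => ?_
    change ExteriorAlgebra.ι K _ * (ExteriorAlgebra.ι K _ * f) = 0
    rw [← mul_assoc, ExteriorAlgebra.ι_sq_zero, zero_mul]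
  x_mul_x i j := by
    refine LinearMap.ext fun f => ?_
    change ExteriorAlgebra.ι K _ * (ExteriorAlgebra.ι K _ * f) =
      -(ExteriorAlgebra.ι K _ * (ExteriorAlgebra.ι K _ * f))
    rw [← mul_assoc, ← mul_assoc, ← neg_mul,
      eq_neg_of_add_eq_zero_left (ExteriorAlgebra.ι_add_mul_swap (R := K) _ _)]
  d_mul_self i := LinearMap.ext fun f => CliffordAlgebra.contractLeft_contractLeft _ f
  d_mul_d i j := LinearMap.ext fun f => CliffordAlgebra.contractLeft_comm _ _ f
  d_mul_x i j := by
    refine LinearMap.ext fun f => (CliffordAlgebra.contractLeft_ι_mul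
      (Q := (0 : QuadraticForm K (ℕ →₀ K))) (d := (Finsupp.lapply i : (ℕ →₀ K) →ₗ[K] K))
      (Finsupp.single j (1 : K)) f).trans ?_
    by_cases hij : i = j
    · subst hij
      rw [if_pos rfl, Finsupp.lapply_apply, Finsupp.single_eq_same, one_smul]
      rfl
    · rw [if_neg hij, Finsupp.lapply_apply, Finsupp.single_eq_of_ne hij, zero_smul]
      rfl
  v_eq := pivot_eq K
  v_eventually := pivot_eventually K
  d_vacuum _ := CliffordAlgebra.contractLeft_one _ _
  span_word := span_word_one K

theorem xop_mem_endParity (i : ℕ) : xop K i ∈ endParity K 1 := fun j f hf => by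
  rw [add_comm]
  exact SetLike.mul_mem_graded (CliffordAlgebra.ι_mem_evenOdd_one _ _) hf

theorem dop_mem_endParity (i : ℕ) : dop K i ∈ endParity K 1 := by
  intro j f hf
  have h1 : ∀ m : ℕ →₀ K, ∀ g ∈ grParity K j,
      CliffordAlgebra.ι (0 : QuadraticForm K (ℕ →₀ K)) m * g ∈ grParity K (j + 1) := by
    intro m g hg
    rw [add_comm]
    exact SetLike.mul_mem_graded (CliffordAlgebra.ι_mem_evenOdd_one _ _) hg
  have h2 : ∀ m : ℕ →₀ K, ∀ g ∈ grParity K (j + 1),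
      CliffordAlgebra.ι (0 : QuadraticForm K (ℕ →₀ K)) m * g ∈ grParity K j := fun m g hg => by
    have := SetLike.mul_mem_graded (CliffordAlgebra.ι_mem_evenOdd_one
      (0 : QuadraticForm K (ℕ →₀ K)) m) hg
    rwa [add_left_comm, show (1 + 1 : ZMod 2) = 0 from rfl, add_zero] at this
  induction f, hf using CliffordAlgebra.evenOdd_induction with
  | range_ι_pow v hv =>
    obtain rfl | rfl := zmod_two_cases j
    · rw [ZMod.val_zero, pow_zero] at hv
      obtain ⟨r, rfl⟩ := Submodule.mem_one.1 hv
      rw [dop, CliffordAlgebra.contractLeft_algebraMap]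
      exact Submodule.zero_mem _
    · rw [ZMod.val_one, pow_one] at hv
      obtain ⟨m, rfl⟩ := hv
      rw [dop, CliffordAlgebra.contractLeft_ι]
      rw [show (1 + 1 : ZMod 2) = 0 from rfl, Algebra.algebraMap_eq_smul_one]
      exact Submodule.smul_mem _ _ (Submodule.one_le.1 (CliffordAlgebra.one_le_evenOdd_zero _))
  | add x y hx hy ihx ihy => rw [map_add]; exact Submodule.add_mem _ ihx ihy
  | ι_mul_ι_mul m₁ m₂ x hx ih =>
    rw [dop, mul_assoc, CliffordAlgebra.contractLeft_ι_mul, CliffordAlgebra.contractLeft_ι_mul]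
    refine Submodule.sub_mem _ (Submodule.smul_mem _ _ (h1 _ _ hx)) (h1 _ _ ?_)
    exact Submodule.sub_mem _ (Submodule.smul_mem _ _ hx) (h2 _ _ ih)

theorem mul_mem_endParity {p q : ZMod 2} {a b : Module.End K (Gr K)} (ha : a ∈ endParity K p)
    (hb : b ∈ endParity K q) : a * b ∈ endParity K (p + q) := fun j f hf => by
  rw [add_comm p, ← add_assoc]
  exact ha _ _ (hb j f hf)

theorem word_mem_endParity (L : List ℕ) : word (xop K) L ∈ endParity K L.length := by
  induction L with
  | nil => intro j f hf; simpa using hf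
  | cons i L ih =>
    rw [word_cons, List.length_cons, Nat.cast_succ, add_comm]
    exact mul_mem_endParity K (xop_mem_endParity K i) ih

theorem pivotTerm_mem_endParity (k : ℕ) : ∀ n, pivotTerm K n k ∈ endParity K 1 := by
  induction k with
  | zero => exact dop_mem_endParity K
  | succ k ih =>
    intro n
    have := mul_mem_endParity K (mul_mem_endParity K (xop_mem_endParity K n)
      (xop_mem_endParity K (n + 1))) (ih (n + 3))
    rwa [show (1 + 1 + 1 : ZMod 2) = 1 from rfl] at this

theorem pivot_mem_endParity (n : ℕ) : pivot K n ∈ endParity K 1 := fun j f hf => by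
  rw [pivot_apply]
  exact finsum_induction (· ∈ grParity K (j + 1)) (Submodule.zero_mem _)
    (fun _ _ => Submodule.add_mem _) fun k => pivotTerm_mem_endParity K k n j f hf

theorem monoSpan_le_endParity (p : ZMod 2) (γ : Fin 3 → ℤ) :
    monoSpan (xop K) (pivot K) p γ ≤ endParity K p := by
  refine Submodule.span_le.2 ?_
  rintro _ ⟨L, n, -, rfl, -, rfl⟩
  exact mul_mem_endParity K (word_mem_endParity K L) (pivot_mem_endParity K n)

theorem sum_proj (f : Gr K) : ∑ j : ZMod 2, GradedAlgebra.proj (grParity K) j f = f := by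
  classical
  conv_rhs => rw [← DirectSum.sum_support_decompose (grParity K) f]
  refine (Finset.sum_subset (Finset.subset_univ _) fun i _ hi => ?_).symm
  rw [GradedAlgebra.proj_apply, DFinsupp.notMem_support_iff.1 hi, ZeroMemClass.coe_zero]

theorem parityComponent_apply (i : ZMod 2) (a : Module.End K (Gr K)) (f : Gr K) :
    parityComponent K i a f = ∑ j : ZMod 2,
      GradedAlgebra.proj (grParity K) (j + i) (a (GradedAlgebra.proj (grParity K) j f)) := by
  simp only [parityComponent, LinearMap.sum_apply, LinearMap.comp_apply,
    LinearMap.mulRight_apply, LinearMap.mulLeft_apply, Module.End.mul_apply]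

theorem parityComponent_of_mem {i : ZMod 2} {a : Module.End K (Gr K)} (ha : a ∈ endParity K i)
    (j : ZMod 2) : parityComponent K j a = if j = i then a else 0 := by
  refine LinearMap.ext fun f => ?_
  have hmem : ∀ k, a (GradedAlgebra.proj (grParity K) k f) ∈ grParity K (k + i) :=
    fun k => ha k _ (SetLike.coe_mem _)
  rw [parityComponent_apply]
  by_cases hij : j = i
  · subst hij
    rw [if_pos rfl]
    conv_rhs => rw [← sum_proj K f, map_sum]
    exact Finset.sum_congr rfl fun k _ => DirectSum.decompose_of_mem_same _ (hmem k)
  · rw [if_neg hij]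
    exact Finset.sum_eq_zero fun k _ => DirectSum.decompose_of_mem_ne _ (hmem k)
      fun h => hij (add_left_cancel h).symm

theorem parityComponent_mem (i : ZMod 2) (a : Module.End K (Gr K)) :
    parityComponent K i a ∈ endParity K i := by
  intro j f hf
  rw [parityComponent_apply]
  refine Submodule.sum_mem _ fun k _ => ?_
  by_cases hk : k = j
  · subst hk; exact SetLike.coe_mem _
  · have : GradedAlgebra.proj (grParity K) k f = 0 :=
      DirectSum.decompose_of_mem_ne _ hf (Ne.symm hk)
    rw [this, map_zero, map_zero]
    exact Submodule.zero_mem _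

theorem sum_parityComponent (a : Module.End K (Gr K)) :
    parityComponent K 0 a + parityComponent K 1 a = a := by
  refine LinearMap.ext fun f => ?_
  conv_rhs => rw [← sum_proj K f, map_sum]
  rw [LinearMap.add_apply, parityComponent_apply, parityComponent_apply, ← Finset.sum_add_distrib]
  refine Finset.sum_congr rfl fun j _ => ?_
  conv_rhs => rw [← sum_proj K (a _)]
  obtain rfl | rfl := zmod_two_cases j
  · rw [zmod_two_sum, zero_add, zero_add]
  · rw [zmod_two_sum, add_comm, add_zero, show (1 + 1 : ZMod 2) = 0 from rfl]

theorem superBracket_eq_sbr {p q : ZMod 2} {a b : Module.End K (Gr K)} (ha : a ∈ endParity K p)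
    (hb : b ∈ endParity K q) : superBracket K a b = sbr p q a b := by
  change (∑ i : ZMod 2, ∑ j : ZMod 2, (parityComponent K i a * parityComponent K j b
        - (-1 : K) ^ (i.val * j.val) • (parityComponent K j b * parityComponent K i a))) = _
  rw [Finset.sum_eq_single p, Finset.sum_eq_single q]
  · rw [parityComponent_of_mem K ha, parityComponent_of_mem K hb, if_pos rfl, if_pos rfl]
    rfl
  · intro j _ hj
    rw [parityComponent_of_mem K hb, if_neg hj]
    simp
  · simp
  · intro j _ hj
    refine Finset.sum_eq_zero fun k _ => ?_
    rw [parityComponent_of_mem K ha, if_neg hj]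
    simp
  · simp

end Concrete

/-! ### The Lie superalgebra structure of `Q` and nilpotency of its homogeneous elements -/

section SuperIdentities

variable {K : Type*} [Field K] {M : Type*} [AddCommGroup M] [Module K M]

theorem sbr_jacobi (i j k : ZMod 2) (a b c : Module.End K M) :
    sbr i (j + k) a (sbr j k b c) = sbr (i + j) k (sbr i j a b) c +
      (-1 : K) ^ (i.val * j.val) • sbr j (i + k) b (sbr i k a c) := by
  have h2 : (1 + 1 : ZMod 2) = 0 := rfl
  rcases zmod_two_cases i with rfl | rfl <;> rcases zmod_two_cases j with rfl | rfl <;>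
    rcases zmod_two_cases k with rfl | rfl <;>
    simp only [sbr, add_zero, zero_add, h2, ZMod.val_zero, ZMod.val_one, mul_zero,
      mul_one, pow_zero, pow_one, one_smul, neg_smul] <;>
    noncomm_ring

theorem sbr_zero_left (q : ZMod 2) (a b : Module.End K M) : sbr 0 q a b = a * b - b * a := by
  simp [sbr]

theorem sbr_zero_right (p : ZMod 2) (a b : Module.End K M) : sbr p 0 a b = a * b - b * a := by
  simp [sbr]

theorem sbr_one_one (a b : Module.End K M) : sbr 1 1 a b = a * b + b * a := by
  simp [sbr, ZMod.val_one]

theorem sbr_one_sbr_one (k : ZMod 2) (a c : Module.End K M) :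
    sbr 1 (1 + k) a (sbr 1 k a c) = a * a * c - c * (a * a) := by
  rcases zmod_two_cases k with rfl | rfl
  · rw [add_zero, sbr_one_one, sbr_zero_right]; noncomm_ring
  · rw [show (1 + 1 : ZMod 2) = 0 from rfl, sbr_one_one, sbr_zero_right]; noncomm_ring

theorem sbr_one_sbr_self (a : Module.End K M) : sbr 1 0 a (sbr 1 1 a a) = 0 := by
  rw [sbr_one_one, sbr_zero_right]; noncomm_ring

/-- The inner derivation of a nilpotent operator is nilpotent. -/
theorem isNilpotent_mulLeft_sub_mulRight {a : Module.End K M} (ha : IsNilpotent a) :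
    IsNilpotent (LinearMap.mulLeft K a - LinearMap.mulRight K a) :=
  (LinearMap.commute_mulLeft_right a a).isNilpotent_sub
    ((LinearMap.isNilpotent_mulLeft_iff K a).2 ha) ((LinearMap.isNilpotent_mulRight_iff K a).2 ha)

theorem isInternal_of_zmod_two {A : ZMod 2 → Submodule K M} (hd : ∀ a ∈ A 0, a ∈ A 1 → a = 0)
    (hs : ∀ a, a ∈ A 0 ⊔ A 1) : DirectSum.IsInternal A := by
  have h01 : (0 : ZMod 2) ≠ 1 := by decide
  refine (DirectSum.isInternal_submodule_iff_isCompl A h01 ?_).2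
    ⟨Submodule.disjoint_def.2 hd, codisjoint_iff.2 (eq_top_iff.2 fun c _ => hs c)⟩
  ext j
  simpa using zmod_two_cases j

end SuperIdentities

/-! ### The span of the admitted monomials as an upper bound for `Q` -/

section Parts

variable (K : Type*) [Field K]

/-- The span of all admitted monomials of parity `p`. -/
def monoPart (p : ZMod 2) : Submodule K (Module.End K (Gr K)) :=
  ⨆ γ, monoSpan (xop K) (pivot K) p γ

theorem monoPart_le_endParity (p : ZMod 2) : monoPart K p ≤ endParity K p :=
  iSup_le fun γ => monoSpan_le_endParity K p γ

theorem superBracket_mem_monoSpan {p q : ZMod 2} {γ δ : Fin 3 → ℤ} {a b : Module.End K (Gr K)}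
    (ha : a ∈ monoSpan (xop K) (pivot K) p γ) (hb : b ∈ monoSpan (xop K) (pivot K) q δ) :
    superBracket K a b ∈ monoSpan (xop K) (pivot K) (p + q) (γ + δ) := by
  rw [superBracket_eq_sbr K (monoSpan_le_endParity K p γ ha) (monoSpan_le_endParity K q δ hb)]
  exact (isPivotSystem K).sbr_mem_monoSpan ha hb

theorem superBracket_mem_monoPart {p q : ZMod 2} {a b : Module.End K (Gr K)}
    (ha : a ∈ monoPart K p) (hb : b ∈ monoPart K q) :
    superBracket K a b ∈ monoPart K (p + q) := by
  induction ha using Submodule.iSup_induction' with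
  | mem γ a ha =>
    induction hb using Submodule.iSup_induction' with
    | mem δ b hb => exact Submodule.mem_iSup_of_mem _ (superBracket_mem_monoSpan K ha hb)
    | zero => rw [map_zero]; exact Submodule.zero_mem _
    | add b c _ _ hb hc => rw [map_add]; exact Submodule.add_mem _ hb hc
  | zero => rw [map_zero, LinearMap.zero_apply]; exact Submodule.zero_mem _
  | add a c _ _ ha hc => rw [map_add, LinearMap.add_apply]; exact Submodule.add_mem _ ha hc

/-- Squaring is a quadratic map whose polar form on odd elements is the supercommutator, so it is
enough to square monomials. This works in every characteristic. -/
theorem mul_self_mem_monoPart {a : Module.End K (Gr K)} (ha : a ∈ monoPart K 1) :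
    a * a ∈ monoPart K 0 := by
  have ha' := ha
  rw [monoPart] at ha'
  simp only [monoSpan, Submodule.iSup_span] at ha'
  clear ha
  induction ha' using Submodule.span_induction with
  | mem a ha =>
    obtain ⟨γ, L, n, hL, hp, -, rfl⟩ := Set.mem_iUnion.1 ha
    exact Submodule.mem_iSup_of_mem _ ((isPivotSystem K).mul_self_word_mul_v_mem hL hp)
  | zero => rw [mul_zero]; exact Submodule.zero_mem _
  | add a b hma hmb ha hb =>
    have hma' : a ∈ monoPart K 1 := by
      rw [monoPart]; simpa only [monoSpan, Submodule.iSup_span] using hma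
    have hmb' : b ∈ monoPart K 1 := by
      rw [monoPart]; simpa only [monoSpan, Submodule.iSup_span] using hmb
    have h := superBracket_mem_monoPart K hma' hmb'
    rw [superBracket_eq_sbr K (monoPart_le_endParity K 1 hma') (monoPart_le_endParity K 1 hmb'),
      sbr_one_one] at h
    have e : (a + b) * (a + b) = a * a + (a * b + b * a) + b * b := by
      rw [add_mul, mul_add, mul_add]; abel
    rw [e]
    exact Submodule.add_mem _ (Submodule.add_mem _ ha h) hb
  | smul r a _ ha =>
    rw [smul_mul_assoc, mul_smul_comm]
    exact Submodule.smul_mem _ _ (Submodule.smul_mem _ _ ha)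

theorem parityComponent_monoPart_sup {a b : Module.End K (Gr K)} (ha : a ∈ monoPart K 0)
    (hb : b ∈ monoPart K 1) (i : ZMod 2) :
    parityComponent K i (a + b) = if i = 0 then a else b := by
  rw [map_add, parityComponent_of_mem K (monoPart_le_endParity K 0 ha),
    parityComponent_of_mem K (monoPart_le_endParity K 1 hb)]
  rcases zmod_two_cases i with rfl | rfl <;> simp

/-- Nilpotency and the dimension bound pass to subspaces, so this larger subsuperalgebra can replace
`Q`. -/
theorem isLieSubsuperalgebra_monoPart_sup :
    IsLieSubsuperalgebra K (monoPart K 0 ⊔ monoPart K 1) where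
  component_mem i a ha := by
    obtain ⟨b, hb, c, hc, rfl⟩ := Submodule.mem_sup.1 ha
    rw [parityComponent_monoPart_sup K hb hc]
    split_ifs
    · exact Submodule.mem_sup_left hb
    · exact Submodule.mem_sup_right hc
  bracket_mem a ha b hb := by
    obtain ⟨a₀, ha₀, a₁, ha₁, rfl⟩ := Submodule.mem_sup.1 ha
    obtain ⟨b₀, hb₀, b₁, hb₁, rfl⟩ := Submodule.mem_sup.1 hb
    have hle : ∀ p, monoPart K p ≤ monoPart K 0 ⊔ monoPart K 1 := fun p => by
      rcases zmod_two_cases p with rfl | rfl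
      · exact le_sup_left
      · exact le_sup_right
    rw [map_add, map_add, LinearMap.add_apply, LinearMap.add_apply]
    exact Submodule.add_mem _
      (Submodule.add_mem _ (hle _ (superBracket_mem_monoPart K ha₀ hb₀))
        (hle _ (superBracket_mem_monoPart K ha₁ hb₀)))
      (Submodule.add_mem _ (hle _ (superBracket_mem_monoPart K ha₀ hb₁))
        (hle _ (superBracket_mem_monoPart K ha₁ hb₁)))
  square_mem _ a ha hodd := by
    obtain ⟨b, hb, c, hc, rfl⟩ := Submodule.mem_sup.1 ha
    have h1 := parityComponent_of_mem K hodd 1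
    rw [parityComponent_monoPart_sup K hb hc, if_pos rfl, if_neg (by decide)] at h1
    rw [← h1]
    exact Submodule.mem_sup_left (mul_self_mem_monoPart K hc)

theorem Q_le : Q K ≤ monoPart K 0 ⊔ monoPart K 1 :=
  sInf_le ⟨isLieSubsuperalgebra_monoPart_sup K, fun _ =>
    Submodule.mem_sup_right (Submodule.mem_iSup_of_mem _ (v_mem_monoSpan _ _ _))⟩

theorem mem_monoPart_of_mem_Q {p : ZMod 2} {a : Module.End K (Gr K)} (ha : a ∈ Q K)
    (hp : a ∈ endParity K p) : a ∈ monoPart K p := by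
  obtain ⟨b, hb, c, hc, rfl⟩ := Submodule.mem_sup.1 (Q_le K ha)
  have h1 := parityComponent_of_mem K hp p
  rw [parityComponent_monoPart_sup K hb hc, if_pos rfl] at h1
  rw [← h1]
  rcases zmod_two_cases p with rfl | rfl
  · exact hb
  · exact hc

theorem isLieSubsuperalgebra_Q : IsLieSubsuperalgebra K (Q K) where
  component_mem i a ha := (Submodule.mem_sInf).2 fun S hS =>
    hS.1.component_mem i a ((Submodule.mem_sInf).1 ha S hS)
  bracket_mem a ha b hb := Q_bracket_mem K ⟨a, ha⟩ ⟨b, hb⟩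
  square_mem h2 a ha hodd := (Submodule.mem_sInf).2 fun S hS =>
    hS.1.square_mem h2 a ((Submodule.mem_sInf).1 ha S hS) hodd

theorem coe_qBracket (a b : Q K) :
    (qBracket K a b : Module.End K (Gr K)) = superBracket K a b := rfl

theorem coe_qBracket_eq_sbr {p q : ZMod 2} {a b : Q K} (ha : a ∈ qParity K p)
    (hb : b ∈ qParity K q) : (qBracket K a b : Module.End K (Gr K)) = sbr p q ↑a ↑b :=
  superBracket_eq_sbr K ha hb

theorem sbr_mem_endParity {p q : ZMod 2} {a b : Module.End K (Gr K)} (ha : a ∈ endParity K p)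
    (hb : b ∈ endParity K q) : sbr p q a b ∈ endParity K (p + q) := by
  refine Submodule.sub_mem _ (mul_mem_endParity K ha hb) (Submodule.smul_mem _ _ ?_)
  rw [add_comm]
  exact mul_mem_endParity K hb ha

theorem qBracket_mem_qParity {p q : ZMod 2} {a b : Q K} (ha : a ∈ qParity K p)
    (hb : b ∈ qParity K q) : qBracket K a b ∈ qParity K (p + q) := by
  change (qBracket K a b : Module.End K (Gr K)) ∈ endParity K (p + q)
  rw [coe_qBracket_eq_sbr K ha hb]
  exact sbr_mem_endParity K ha hb

/-- Every element of `Q` is a sum of an even and an odd one. -/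
theorem exists_eq_add_qParity (c : Q K) :
    ∃ c₀ ∈ qParity K 0, ∃ c₁ ∈ qParity K 1, c = c₀ + c₁ :=
  ⟨⟨_, (isLieSubsuperalgebra_Q K).component_mem 0 c c.2⟩, parityComponent_mem K 0 c,
    ⟨_, (isLieSubsuperalgebra_Q K).component_mem 1 c c.2⟩, parityComponent_mem K 1 c,
    Subtype.ext (sum_parityComponent K c).symm⟩

theorem superBracket_of_even {a : Module.End K (Gr K)} (ha : a ∈ endParity K 0) :
    superBracket K a = LinearMap.mulLeft K a - LinearMap.mulRight K a := by
  refine LinearMap.ext fun b => ?_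
  rw [LinearMap.sub_apply, LinearMap.mulLeft_apply, LinearMap.mulRight_apply]
  conv_lhs => rw [← sum_parityComponent K b]
  rw [map_add, superBracket_eq_sbr K ha (parityComponent_mem K 0 b),
    superBracket_eq_sbr K ha (parityComponent_mem K 1 b), sbr_zero_left, sbr_zero_left]
  conv_rhs => rw [← sum_parityComponent K b]
  rw [mul_add, add_mul]
  abel

/-- This is `ad(a)² = ad(a²)`, which reduces nilpotency for odd elements to even ones without
dividing by 2. -/
theorem superBracket_superBracket_of_odd {a : Module.End K (Gr K)} (ha : a ∈ endParity K 1)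
    (b : Module.End K (Gr K)) :
    superBracket K a (superBracket K a b) = a * a * b - b * (a * a) := by
  have key : ∀ k, superBracket K a (superBracket K a (parityComponent K k b)) =
      a * a * parityComponent K k b - parityComponent K k b * (a * a) := fun k => by
    have hb := parityComponent_mem K k b
    rw [superBracket_eq_sbr K ha hb, superBracket_eq_sbr K ha (sbr_mem_endParity K ha hb),
      sbr_one_sbr_one]
  conv_lhs => rw [← sum_parityComponent K b]
  rw [map_add, map_add, key, key]
  conv_rhs => rw [← sum_parityComponent K b]
  rw [mul_add, add_mul]
  abel

theorem isNilpotent_superBracket {p : ZMod 2} {a : Module.End K (Gr K)} (ha : a ∈ monoPart K p) :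
    IsNilpotent (superBracket K a) := by
  have hp := monoPart_le_endParity K p ha
  rcases zmod_two_cases p with rfl | rfl
  · rw [superBracket_of_even K hp]
    exact isNilpotent_mulLeft_sub_mulRight ((isPivotSystem K).isNilpotent_of_even ha)
  · have h2 := isNilpotent_mulLeft_sub_mulRight
      ((isPivotSystem K).isNilpotent_of_even (mul_self_mem_monoPart K ha))
    refine IsNilpotent.of_pow (m := 2) ?_
    have e : superBracket K a ^ 2 = LinearMap.mulLeft K (a * a) - LinearMap.mulRight K (a * a) :=
      LinearMap.ext fun b => by
        rw [pow_two]
        exact superBracket_superBracket_of_odd K hp b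
    rwa [e]

theorem isNilpotent_qBracket {p : ZMod 2} {a : Q K} (ha : a ∈ qParity K p) :
    IsNilpotent (qBracket K a) := by
  obtain ⟨k, hk⟩ := isNilpotent_superBracket K (mem_monoPart_of_mem_Q K a.2 ha)
  have key : ∀ k (b : Q K), (((qBracket K a ^ k) b : Q K) : Module.End K (Gr K)) =
      (superBracket K (a : Module.End K (Gr K)) ^ k) b := by
    intro k
    induction k with
    | zero => exact fun b => rfl
    | succ k ih =>
      intro b
      rw [pow_succ, pow_succ, Module.End.mul_apply, Module.End.mul_apply, ih, coe_qBracket]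
  exact ⟨k, LinearMap.ext fun b => Subtype.ext (by rw [key, hk]; rfl)⟩

theorem qBracket_jacobi {i j : ZMod 2} {a b : Q K} (ha : a ∈ qParity K i) (hb : b ∈ qParity K j)
    (c : Q K) : qBracket K a (qBracket K b c) =
      qBracket K (qBracket K a b) c +
      (-1 : K) ^ (i.val * j.val) • qBracket K b (qBracket K a c) := by
  have key : ∀ k, ∀ c ∈ qParity K k, qBracket K a (qBracket K b c) = qBracket K (qBracket K a b) c +
      (-1 : K) ^ (i.val * j.val) • qBracket K b (qBracket K a c) := by
    intro k c hc
    refine Subtype.ext ?_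
    rw [Submodule.coe_add, Submodule.coe_smul,
      coe_qBracket_eq_sbr K ha (qBracket_mem_qParity K hb hc),
      coe_qBracket_eq_sbr K (qBracket_mem_qParity K ha hb) hc,
      coe_qBracket_eq_sbr K hb (qBracket_mem_qParity K ha hc), coe_qBracket_eq_sbr K hb hc,
      coe_qBracket_eq_sbr K ha hb, coe_qBracket_eq_sbr K ha hc]
    exact sbr_jacobi i j k _ _ _
  obtain ⟨c₀, h₀, c₁, h₁, rfl⟩ := exists_eq_add_qParity K c
  simp only [map_add, key 0 c₀ h₀, key 1 c₁ h₁, smul_add]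
  abel

theorem isLieSuperalgebra_Q : IsLieSuperalgebra (L := Q K) (qParity K) (qBracket K) where
  isInternal := isInternal_of_zmod_two (M := Q K) (fun a h0 h1 => by
      have e0 := parityComponent_of_mem K h0 0
      have e1 := parityComponent_of_mem K h1 0
      rw [if_pos rfl] at e0
      rw [if_neg (by decide)] at e1
      exact Subtype.ext (e0.symm.trans e1)) fun c => by
    obtain ⟨c₀, h₀, c₁, h₁, rfl⟩ := exists_eq_add_qParity K c
    exact Submodule.add_mem_sup h₀ h₁
  bracket_mem _ _ _ ha _ hb := qBracket_mem_qParity K ha hb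
  anticomm i j a ha b hb := Subtype.ext <| by
    rw [coe_qBracket_eq_sbr K ha hb, sbr_swap, Submodule.coe_neg, Submodule.coe_smul,
      coe_qBracket_eq_sbr K hb ha]
  jacobi _ _ _ ha _ hb c := qBracket_jacobi K ha hb c
  char_three _ z hz := Subtype.ext <| by
    rw [coe_qBracket_eq_sbr K hz (qBracket_mem_qParity K hz hz), coe_qBracket_eq_sbr K hz hz]
    exact sbr_one_sbr_self _
  char_two h2 := by
    classical
    have hsq : ∀ x ∈ qParity K 1, (x * x : Module.End K (Gr K)) ∈ Q K := fun x hx =>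
      (isLieSubsuperalgebra_Q K).square_mem h2 x x.2 hx
    have hpar : ∀ x ∈ qParity K 1, (x * x : Module.End K (Gr K)) ∈ endParity K 0 := fun x hx =>
      mul_mem_endParity K (p := 1) (q := 1) hx hx
    refine ⟨fun x hx => Subtype.ext ?_,
      fun x => if hx : x ∈ qParity K 1 then ⟨_, hsq x hx⟩ else 0, fun x hx => ?_,
      fun c x hx => ?_, fun x hx y hy => ?_, fun x hx z => Subtype.ext ?_⟩
    · rw [coe_qBracket_eq_sbr K hx hx, sbr_zero_left, sub_self]; rfl
    · simp only [dif_pos hx]; exact hpar x hx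
    · simp only [dif_pos hx, dif_pos (Submodule.smul_mem _ c hx)]
      refine Subtype.ext ?_
      change (c • (x : Module.End K (Gr K))) * (c • (x : Module.End K (Gr K))) = 
        c ^ 2 • (x * x : Module.End K (Gr K))
      rw [smul_mul_assoc, mul_smul_comm, smul_smul, pow_two]
    · simp only [dif_pos hx, dif_pos hy, dif_pos (Submodule.add_mem _ hx hy)]
      refine Subtype.ext ?_
      change ((x : Module.End K (Gr K)) + y) * (x + y) =
        (x * x : Module.End K (Gr K)) + superBracket K x y + (y * y : Module.End K (Gr K))
      rw [superBracket_eq_sbr K (a := (x : Module.End K (Gr K))) (b := y) hx hy, sbr_one_one,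
        add_mul, mul_add, mul_add]
      abel
    · simp only [dif_pos hx]
      rw [coe_qBracket, coe_qBracket, superBracket_superBracket_of_odd K (a := x) hx,
        coe_qBracket, superBracket_of_even K (hpar x hx)]
      rfl

end Parts

/-! ### The grading by multidegree -/

section Scaling

variable {K : Type*} [Field K] {M : Type*} [AddCommGroup M] [Module K M]

/-- The character `γ ↦ 2^{γ_0} 3^{γ_1} 5^{γ_2}` of `ℤ³`. -/
def weightChar (K : Type*) [Field K] (γ : Fin 3 → ℤ) : K := 2 ^ γ 0 * 3 ^ γ 1 * 5 ^ γ 2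

theorem weightChar_zero : weightChar K 0 = 1 := by simp [weightChar]

theorem iSupIndep_of_map_subtype {ι : Type*} {S : Submodule K M} {A : ι → Submodule K S}
    (h : iSupIndep fun i => (A i).map S.subtype) : iSupIndep A := by
  intro i
  refine Submodule.disjoint_def.2 fun x h1 h2 => Subtype.ext ?_
  refine Submodule.disjoint_def.1 (h i) x (Submodule.mem_map_of_mem h1) ?_
  have := Submodule.mem_map_of_mem (f := S.subtype) h2
  simp only [Submodule.map_iSup] at this
  exact this

theorem isInternal_of_iSupIndep {ι : Type*} [DecidableEq ι] {A : ι → Submodule K M}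
    (h : iSupIndep A) (ht : ∀ a, a ∈ ⨆ i, A i) : DirectSum.IsInternal A :=
  (DirectSum.isInternal_submodule_iff_iSupIndep_and_iSup_eq_top A).2 
    ⟨h, eq_top_iff.2 fun a _ => ht a⟩

theorem rank_le_one_of_map_subtype_le {S : Submodule K M} {A : Submodule K S} {a : M}
    (h : A.map S.subtype ≤ Submodule.span K {a}) : Module.rank K A ≤ 1 :=
  calc Module.rank K A = Module.rank K (A.map S.subtype) :=
        (LinearEquiv.rank_eq (Submodule.equivMapOfInjective S.subtype S.injective_subtype A))
    _ ≤ Module.rank K (Submodule.span K {a}) := Submodule.rank_mono h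
    _ ≤ 1 := (rank_span_le _).trans (by simp)

variable [CharZero K]

theorem weightChar_add (γ δ : Fin 3 → ℤ) :
    weightChar K (γ + δ) = weightChar K γ * weightChar K δ := by
  simp only [weightChar, Pi.add_apply]
  rw [zpow_add₀ two_ne_zero, zpow_add₀ three_ne_zero, zpow_add₀ (by norm_num : (5 : K) ≠ 0)]
  ring

theorem weightChar_neg_mul (γ : Fin 3 → ℤ) : weightChar K (-γ) * weightChar K γ = 1 := by
  rw [← weightChar_add, neg_add_cancel, weightChar_zero]

/-- In characteristic zero the values come from `ℚ`, where the valuations at 2, 3 and 5 recover the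
exponents. -/
theorem weightChar_injective : Function.Injective (weightChar K) := by
  have key : ∀ γ : Fin 3 → ℤ, weightChar K γ = ((weightChar ℚ γ : ℚ) : K) := fun γ => by
    simp [weightChar]
  intro γ δ h
  rw [key, key, Rat.cast_inj] at h
  have hp : ∀ p : ℕ, [Fact p.Prime] → ∀ γ : Fin 3 → ℤ, padicValRat p (weightChar ℚ γ) =
      γ 0 * padicValRat p (2 : ℕ) + γ 1 * padicValRat p (3 : ℕ) + γ 2 * padicValRat p (5 : ℕ) := by
    intro p _ γ
    rw [weightChar, padicValRat.mul (by positivity) (by positivity),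
      padicValRat.mul (by positivity) (by positivity), padicValRat.zpow, padicValRat.zpow,
      padicValRat.zpow]
    rfl
  have h2 : Fact (Nat.Prime 2) := ⟨by norm_num⟩
  have h3 : Fact (Nat.Prime 3) := ⟨by norm_num⟩
  have h5 : Fact (Nat.Prime 5) := ⟨by norm_num⟩
  have v : ∀ p q : ℕ, ¬ p ∣ q → padicValRat p (q : ℚ) = 0 := fun p q hpq => by
    rw [padicValRat.of_nat, padicValNat.eq_zero_of_not_dvd hpq, Nat.cast_zero]
  have e2 := (hp 2 γ).symm.trans ((congrArg (padicValRat 2) h).trans (hp 2 δ))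
  have e3 := (hp 3 γ).symm.trans ((congrArg (padicValRat 3) h).trans (hp 3 δ))
  have e5 := (hp 5 γ).symm.trans ((congrArg (padicValRat 5) h).trans (hp 5 δ))
  rw [v 2 3 (by norm_num), v 2 5 (by norm_num), padicValRat.self (by norm_num)] at e2
  rw [v 3 2 (by norm_num), v 3 5 (by norm_num), padicValRat.self (by norm_num)] at e3
  rw [v 5 2 (by norm_num), v 5 3 (by norm_num), padicValRat.self (by norm_num)] at e5
  ext i
  fin_cases i <;> simp_all

namespace IsPivotSystem

variable {X D V : ℕ → Module.End K M} {e : M} (h : IsPivotSystem X D V e)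
  {Φ : Module.End K M}
  (hX : ∀ i, Φ * X i = weightChar K (-pivotWeight i) • (X i * Φ))
  (hD : ∀ i, Φ * D i = weightChar K (pivotWeight i) • (D i * Φ))

include h hX hD in
-- Conjugation by `Φ` scales all summands of `V n` equally, by the recursion for the weights; as the
-- sum is infinite, the identity is descended on a single vector.
theorem scaling_mul_v (n : ℕ) : Φ * V n = weightChar K (pivotWeight n) • (V n * Φ) := by
  refine LinearMap.ext fun f => ?_
  obtain ⟨N₁, h₁⟩ := h.v_eventually f
  obtain ⟨N₂, h₂⟩ := h.v_eventually (Φ f)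
  suffices ∀ d m, N₁ + N₂ ≤ m + d → (Φ * V m) f = (weightChar K (pivotWeight m) • (V m * Φ)) f from
    this (N₁ + N₂) n (by omega)
  intro d
  induction d with
  | zero =>
    intro m hN
    simp [h₁ m (by omega), h₂ m (by omega)]
  | succ d ih =>
    intro m hN
    have h3 := ih (m + 3) (by omega)
    have h4 : Φ * V m = weightChar K (pivotWeight m) • (D m * Φ) +
        weightChar K (-pivotWeight m + -pivotWeight (m + 1)) •
          (X m * X (m + 1) * (Φ * V (m + 3))) := by
      rw [h.v_eq m, mul_add, hD m, ← mul_assoc, ← mul_assoc, hX m, smul_mul_assoc,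
        mul_assoc (X m), hX (m + 1), mul_smul_comm, smul_smul, ← weightChar_add, smul_mul_assoc]
      simp only [mul_assoc]
    have h5 : weightChar K (pivotWeight m) • (V m * Φ) =
        weightChar K (pivotWeight m) • (D m * Φ) +
        weightChar K (-pivotWeight m + -pivotWeight (m + 1)) •
          (X m * X (m + 1) * (weightChar K (pivotWeight (m + 3)) • (V (m + 3) * Φ))) := by
      rw [mul_smul_comm, smul_smul, ← weightChar_add, pivotWeight_add_three,
        show -pivotWeight m + -pivotWeight (m + 1) + (2 • pivotWeight m + pivotWeight (m + 1)) =
          pivotWeight m by module, ← smul_add, ← mul_assoc, ← add_mul, ← h.v_eq]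
    rw [h4, h5, LinearMap.add_apply, LinearMap.add_apply, LinearMap.smul_apply _ (_ * _ * (Φ * _)),
      Module.End.mul_apply (X m * X (m + 1)), h3, LinearMap.smul_apply _ (_ * (_ • _)),
      ← Module.End.mul_apply (X m * X (m + 1))]

include hX in
theorem scaling_mul_word (L : List ℕ) :
    Φ * word X L = weightChar K (-(L.map pivotWeight).sum) • (word X L * Φ) := by
  induction L with
  | nil => simp [weightChar_zero]
  | cons i L ih =>
    rw [word_cons, ← mul_assoc, hX, smul_mul_assoc, mul_assoc, ih, mul_smul_comm, smul_smul,
      ← weightChar_add, ← mul_assoc, List.map_cons, List.sum_cons, neg_add]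

include h hX hD in
theorem scaling_mul_of_mem_monoSpan {p : ZMod 2} {γ : Fin 3 → ℤ} {a : Module.End K M}
    (ha : a ∈ monoSpan X V p γ) : Φ * a = weightChar K γ • (a * Φ) := by
  induction ha using Submodule.span_induction with
  | mem a ha =>
    obtain ⟨L, n, -, -, rfl, rfl⟩ := ha
    rw [← mul_assoc, scaling_mul_word hX, smul_mul_assoc, mul_assoc, h.scaling_mul_v hX hD,
      mul_smul_comm, smul_smul, ← weightChar_add, ← mul_assoc, monoWeight, neg_add_eq_sub]
  | zero => simp
  | add a b _ _ ha hb => rw [mul_add, ha, hb, add_mul, smul_add]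
  | smul r a _ ha => rw [mul_smul_comm, ha, smul_mul_assoc, smul_comm]

end IsPivotSystem

/-- Subspaces on which an invertible operator acts by conjugation with distinct characters are
independent. -/
theorem iSupIndep_of_scaling {Φ Ψ : Module.End K M} (hΦΨ : Φ * Ψ = 1)
    {A : (Fin 3 → ℤ) → Submodule K (Module.End K M)}
    (hA : ∀ γ, ∀ a ∈ A γ, Φ * a = weightChar K γ • (a * Φ)) : iSupIndep A := by
  have h := (Module.End.eigenspaces_iSupIndep
    (LinearMap.mulLeft K Φ ∘ₗ LinearMap.mulRight K Ψ)).comp (weightChar_injective (K := K))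
  refine h.mono fun γ a ha => Module.End.mem_eigenspace_iff.2 ?_
  rw [LinearMap.comp_apply, LinearMap.mulRight_apply, LinearMap.mulLeft_apply, ← mul_assoc,
    hA γ a ha, smul_mul_assoc, mul_assoc, hΦΨ, mul_one]

end Scaling

/-! ### Rescaling of the letters and the `ℤ³`-grading of `Q` -/

section Grading

variable (K : Type*) [Field K]

/-- The linear map that multiplies the `i`-th coordinate by `s i`. -/
def coordScale (s : ℕ → K) : (ℕ →₀ K) →ₗ[K] (ℕ →₀ K) :=
  Finsupp.linearCombination K fun i => Finsupp.single i (s i)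

theorem coordScale_single (s : ℕ → K) (i : ℕ) (c : K) :
    coordScale K s (Finsupp.single i c) = s i • Finsupp.single i c := by
  rw [coordScale, Finsupp.linearCombination_single, Finsupp.smul_single, Finsupp.smul_single,
    smul_eq_mul, smul_eq_mul, mul_comm]

theorem coordScale_apply (s : ℕ → K) (m : ℕ →₀ K) (i : ℕ) : coordScale K s m i = s i * m i := by
  induction m using Finsupp.induction_linear with
  | zero => simp
  | add m n hm hn => rw [map_add, Finsupp.add_apply, hm, hn, Finsupp.add_apply, mul_add]
  | single j c =>
    rw [coordScale_single, Finsupp.smul_apply, smul_eq_mul]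
    by_cases hij : i = j
    · rw [hij]
    · rw [Finsupp.single_eq_of_ne hij, mul_zero, mul_zero]

/-- The automorphism of the Grassmann algebra that multiplies `x_i` by `s i`. -/
def grScale (s : ℕ → K) : Module.End K (Gr K) :=
  (ExteriorAlgebra.map (coordScale K s)).toLinearMap

theorem grScale_ι_mul (s : ℕ → K) (m : ℕ →₀ K) (f : Gr K) :
    grScale K s (ExteriorAlgebra.ι K m * f) =
      ExteriorAlgebra.ι K (coordScale K s m) * grScale K s f := by
  rw [grScale, AlgHom.toLinearMap_apply, map_mul, ExteriorAlgebra.map_apply_ι]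
  rfl

theorem grScale_mul_xop (s : ℕ → K) (i : ℕ) :
    grScale K s * xop K i = s i • (xop K i * grScale K s) := by
  refine LinearMap.ext fun f => (grScale_ι_mul K s _ f).trans ?_
  rw [coordScale_single, map_smul, smul_mul_assoc]
  rfl

theorem dop_ι_mul (i : ℕ) (m : ℕ →₀ K) (f : Gr K) :
    dop K i (ExteriorAlgebra.ι K m * f) = m i • f - ExteriorAlgebra.ι K m * dop K i f :=
  CliffordAlgebra.contractLeft_ι_mul (Q := (0 : QuadraticForm K (ℕ →₀ K)))
    (d := (Finsupp.lapply i : (ℕ →₀ K) →ₗ[K] K)) m f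

theorem dop_grScale (s : ℕ → K) (i : ℕ) (f : Gr K) :
    dop K i (grScale K s f) = s i • grScale K s (dop K i f) := by
  induction f using CliffordAlgebra.left_induction with
  | algebraMap r =>
    have h1 : grScale K s (algebraMap K (Gr K) r) = algebraMap K (Gr K) r := AlgHom.commutes _ r
    have h2 : dop K i (algebraMap K (Gr K) r) = 0 := CliffordAlgebra.contractLeft_algebraMap _ _ r
    exact (congrArg (dop K i) h1).trans (h2.trans (by
      refine Eq.symm ((congrArg (fun z => s i • grScale K s z) h2).trans ?_)
      simp only [map_zero, smul_zero]))
  | add a b ha hb => simp only [map_add, ha, hb, smul_add]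
  | ι_mul f m hf =>
    refine (congrArg (dop K i) (grScale_ι_mul K s m f)).trans ((dop_ι_mul K i _ _).trans ?_)
    refine Eq.trans ?_ (congrArg (fun z => s i • grScale K s z) (dop_ι_mul K i m f)).symm
    simp only [map_sub, map_smul, grScale_ι_mul, hf, coordScale_apply, smul_sub, mul_smul_comm,
      smul_smul]

theorem grScale_mul_grScale {s t : ℕ → K} (hst : ∀ i, s i * t i = 1) :
    grScale K s * grScale K t = 1 := by
  refine LinearMap.ext fun f => ?_
  have h : coordScale K s ∘ₗ coordScale K t = LinearMap.id := LinearMap.ext fun m =>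
    Finsupp.ext fun i => by
      rw [LinearMap.comp_apply, coordScale_apply, coordScale_apply, ← mul_assoc, hst, one_mul]
      rfl
  have h2 : (ExteriorAlgebra.map (coordScale K s)).comp (ExteriorAlgebra.map (coordScale K t)) =
      AlgHom.id K (Gr K) := by
    rw [ExteriorAlgebra.map_comp_map, h, ExteriorAlgebra.map_id]
  exact congrArg (fun φ : Gr K →ₐ[K] Gr K => φ f) h2

/-- The automorphism that scales each `x_i` by the character of `-w_i` scales `∂_i` by that of
`w_i`. Components of different weights then lie in different eigenspaces of conjugation. -/
theorem iSupIndep_of_le_monoSpan [CharZero K]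
    {A : (Fin 3 → ℤ) → Submodule K (Module.End K (Gr K))}
    (hA : ∀ γ, ∃ p, A γ ≤ monoSpan (xop K) (pivot K) p γ) : iSupIndep A := by
  have hs : ∀ i, weightChar K (-pivotWeight i) * weightChar K (pivotWeight i) = 1 :=
    fun i => weightChar_neg_mul _
  refine iSupIndep_of_scaling (grScale_mul_grScale K hs) fun γ a ha => ?_
  obtain ⟨p, hp⟩ := hA γ
  refine (isPivotSystem K).scaling_mul_of_mem_monoSpan (fun i => grScale_mul_xop K _ i)
    (fun i => LinearMap.ext fun f => ?_) (hp ha)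
  rw [LinearMap.smul_apply, Module.End.mul_apply, Module.End.mul_apply, dop_grScale, smul_smul,
    mul_comm, hs, one_smul]

variable {K} in
theorem mem_monoSpan_of_isLieProduct [CharZero K] {n : Fin 3 → ℕ} {a : Q K}
    (ha : IsLieProduct K n a) : (a : Module.End K (Gr K)) ∈ monoSpan (xop K) (pivot K)
      ((n 0 + n 1 + n 2 : ℕ) : ZMod 2) fun i => (n i : ℤ) := by
  induction ha with
  | gen i =>
    have h := v_mem_monoSpan (xop K) (pivot K) i
    have e : ∀ i : Fin 3, pivotWeight i = fun j => ((Pi.single i 1 : Fin 3 → ℕ) j : ℤ) := by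
      intro i
      funext j
      fin_cases i <;> fin_cases j <;> simp [pivotWeight]
    have e' : ((((Pi.single i 1 : Fin 3 → ℕ) 0 + (Pi.single i 1 : Fin 3 → ℕ) 1 +
        (Pi.single i 1 : Fin 3 → ℕ) 2 : ℕ)) : ZMod 2) = 1 := by
      fin_cases i <;> simp
    rw [e', ← e i]
    exact h
  | @bracket m n a b _ _ ha hb =>
    have h := superBracket_mem_monoSpan K ha hb
    have e : (((m + n) 0 + (m + n) 1 + (m + n) 2 : ℕ) : ZMod 2) =
        ((m 0 + m 1 + m 2 : ℕ) : ZMod 2) + ((n 0 + n 1 + n 2 : ℕ) : ZMod 2) := by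
      simp only [Pi.add_apply]; push_cast; ring
    have e' : (fun i => ((m + n) i : ℤ)) = (fun i => (m i : ℤ)) + fun i => (n i : ℤ) := by
      funext i; simp
    rw [e, e']
    exact h
  | square h2 => exact absurd h2 two_ne_zero

theorem map_qComponent_le [CharZero K] (γ : Fin 3 → ℤ) : (qComponent K γ).map (Q K).subtype ≤
    monoSpan (xop K) (pivot K) ((γ 0 + γ 1 + γ 2 : ℤ) : ZMod 2) γ := by
  rw [Submodule.map_le_iff_le_comap, qComponent]
  refine Submodule.span_le.2 ?_
  rintro a ⟨n, hn, ha⟩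
  have h := mem_monoSpan_of_isLieProduct ha
  have e : (fun i => (n i : ℤ)) = γ := funext hn
  rw [e] at h
  rw [← hn 0, ← hn 1, ← hn 2]
  exact_mod_cast h

theorem qComponent_le_qParity [CharZero K] (γ : Fin 3 → ℤ) :
    qComponent K γ ≤ qParity K ((γ 0 + γ 1 + γ 2 : ℤ) : ZMod 2) := fun _ ha =>
  monoSpan_le_endParity K _ γ (map_qComponent_le K γ (Submodule.mem_map_of_mem ha))

theorem qBracket_mem_qComponent {γ δ : Fin 3 → ℤ} {a b : Q K} (ha : a ∈ qComponent K γ)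
    (hb : b ∈ qComponent K δ) : qBracket K a b ∈ qComponent K (γ + δ) := by
  rw [qComponent] at ha hb
  induction ha, hb using Submodule.span_induction₂ with
  | mem_mem a b ha hb =>
    obtain ⟨m, hm, ha⟩ := ha
    obtain ⟨n, hn, hb⟩ := hb
    exact Submodule.subset_span ⟨m + n, fun i => by
      rw [Pi.add_apply, Pi.add_apply, Nat.cast_add, hm, hn], ha.bracket hb⟩
  | zero_left b _ => rw [map_zero, LinearMap.zero_apply]; exact Submodule.zero_mem _
  | zero_right a _ => rw [map_zero]; exact Submodule.zero_mem _
  | add_left a b c _ _ _ ha hb =>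
    rw [map_add, LinearMap.add_apply]; exact Submodule.add_mem _ ha hb
  | add_right a b c _ _ _ ha hb => rw [map_add]; exact Submodule.add_mem _ ha hb
  | smul_left r a b _ _ ha =>
    rw [map_smul, LinearMap.smul_apply]; exact Submodule.smul_mem _ _ ha
  | smul_right r a b _ _ ha => rw [map_smul]; exact Submodule.smul_mem _ _ ha

theorem qBracket_mem_iSup_qComponent {a b : Q K} (ha : a ∈ ⨆ γ, qComponent K γ)
    (hb : b ∈ ⨆ γ, qComponent K γ) : qBracket K a b ∈ ⨆ γ, qComponent K γ := by
  induction ha using Submodule.iSup_induction' with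
  | mem γ a ha =>
    induction hb using Submodule.iSup_induction' with
    | mem δ b hb => exact Submodule.mem_iSup_of_mem _ (qBracket_mem_qComponent K ha hb)
    | zero => rw [map_zero]; exact Submodule.zero_mem _
    | add b c _ _ hb hc => rw [map_add]; exact Submodule.add_mem _ hb hc
  | zero => rw [map_zero, LinearMap.zero_apply]; exact Submodule.zero_mem _
  | add a c _ _ ha hc => rw [map_add, LinearMap.add_apply]; exact Submodule.add_mem _ ha hc

theorem qGen_mem_qComponent (i : Fin 3) :
    qGen K i ∈ qComponent K fun j => ((Pi.single i 1 : Fin 3 → ℕ) j : ℤ) :=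
  Submodule.subset_span ⟨Pi.single i 1, fun _ => rfl, IsLieProduct.gen i⟩

theorem isLieSubsuperalgebra_iSup_qComponent [CharZero K] :
    IsLieSubsuperalgebra K ((⨆ γ, qComponent K γ).map (Q K).subtype) where
  component_mem i a ha := by
    obtain ⟨a, ha, rfl⟩ := ha
    induction ha using Submodule.iSup_induction' with
    | mem γ a ha =>
      rw [parityComponent_of_mem K (qComponent_le_qParity K γ ha)]
      split_ifs
      · exact Submodule.mem_map_of_mem (Submodule.mem_iSup_of_mem γ ha)
      · exact Submodule.zero_mem _
    | zero => rw [map_zero, map_zero]; exact Submodule.zero_mem _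
    | add a c _ _ ha hc => rw [map_add, map_add]; exact Submodule.add_mem _ ha hc
  bracket_mem a ha b hb := by
    obtain ⟨a, ha, rfl⟩ := ha
    obtain ⟨b, hb, rfl⟩ := hb
    exact ⟨_, qBracket_mem_iSup_qComponent K ha hb, rfl⟩
  square_mem h2 := absurd h2 two_ne_zero

/-- The sum of the components is a subsuperalgebra containing the generators, and `Q` is the
smallest one. -/
theorem mem_iSup_qComponent [CharZero K] (a : Q K) : a ∈ ⨆ γ, qComponent K γ := by
  have h : Q K ≤ (⨆ γ, qComponent K γ).map (Q K).subtype :=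
    sInf_le ⟨isLieSubsuperalgebra_iSup_qComponent K, fun i =>
      ⟨qGen K i, Submodule.mem_iSup_of_mem _ (qGen_mem_qComponent K i), rfl⟩⟩
  obtain ⟨b, hb, hab⟩ := h a.2
  rwa [← Subtype.ext hab]

theorem isGroupGrading_qComponent [CharZero K] :
    IsGroupGrading (L := Q K) (qComponent K) (qBracket K) where
  isInternal := isInternal_of_iSupIndep (M := Q K)
    (iSupIndep_of_map_subtype (M := Module.End K (Gr K))
      (iSupIndep_of_le_monoSpan K fun γ => ⟨_, map_qComponent_le K γ⟩))
    (mem_iSup_qComponent K)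
  bracket_mem _ _ _ ha _ hb := qBracket_mem_qComponent K ha hb

theorem rank_qComponent_le_one [CharZero K] (γ : Fin 3 → ℤ) :
    Module.rank K (qComponent K γ) ≤ 1 := by
  obtain ⟨a, ha⟩ := (isPivotSystem K).exists_monoSpan_le ((γ 0 + γ 1 + γ 2 : ℤ) : ZMod 2) γ
  exact rank_le_one_of_map_subtype_le (M := Module.End K (Gr K)) ((map_qComponent_le K γ).trans ha)

end Grading

/-! ### `Q` is not locally nilpotent -/

section LocalNilpotency

variable (K : Type*) [Field K]

theorem superBracket_pivot_pivot (n : ℕ) :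
    superBracket K (pivot K n) (superBracket K (pivot K n) (pivot K (n + 1))) =
      -pivot K (n + 3) := by
  have h := isPivotSystem K
  rw [superBracket_superBracket_of_odd K (pivot_mem_endParity K n)]
  exact h.v_sq_comm_v_succ n

theorem bracket_mem_generatedSubalgebra {L : Type*} [AddCommGroup L] [Module K L]
    {br : L →ₗ[K] L →ₗ[K] L} {X : Set L} {a b : L} (ha : a ∈ generatedSubalgebra br X)
    (hb : b ∈ generatedSubalgebra br X) : br a b ∈ generatedSubalgebra br X :=
  (Submodule.mem_sInf).2 fun S hS =>
    hS.2 _ ((Submodule.mem_sInf).1 ha S hS) _ ((Submodule.mem_sInf).1 hb S hS)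

theorem subset_generatedSubalgebra {L : Type*} [AddCommGroup L] [Module K L]
    {br : L →ₗ[K] L →ₗ[K] L} {X : Set L} {a : L} (ha : a ∈ X) : a ∈ generatedSubalgebra br X :=
  (Submodule.mem_sInf).2 fun _ hS => hS.1 ha

theorem lowerSeries_eq_bot_of_le {L : Type*} [AddCommGroup L] [Module K L]
    {br : L →ₗ[K] L →ₗ[K] L} {S : Submodule K L} {n m : ℕ} (h : lowerSeries br S n = ⊥)
    (hnm : n ≤ m) : lowerSeries br S m = ⊥ := by
  induction m, hnm using Nat.le_induction with
  | base => exact h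
  | succ m _ ih =>
    refine Submodule.span_eq_bot.2 ?_
    rintro _ ⟨a, -, b, hb, rfl⟩
    rw [ih, Submodule.mem_bot] at hb
    rw [hb, map_zero]

theorem neg_bracket_bracket_mem_lowerSeries {L : Type*} [AddCommGroup L] [Module K L]
    {br : L →ₗ[K] L →ₗ[K] L} {S : Submodule K L} {n : ℕ} {a b : L} (ha : a ∈ S)
    (hb : b ∈ lowerSeries br S n) : -br a (br a b) ∈ lowerSeries br S (n + 2) :=
  Submodule.neg_mem _ (Submodule.subset_span ⟨a, ha, _, Submodule.subset_span ⟨a, ha, b, hb, rfl⟩,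
    rfl⟩)

theorem exists_pivot_mem_generatedSubalgebra (n : ℕ) :
    ∃ a ∈ generatedSubalgebra (qBracket K) (Set.range (qGen K)),
      (a : Module.End K (Gr K)) = pivot K n := by
  induction n using Nat.strong_induction_on with
  | _ n ih =>
    rcases Nat.lt_or_ge n 3 with hn | hn
    · exact ⟨qGen K ⟨n, hn⟩, subset_generatedSubalgebra K ⟨_, rfl⟩, rfl⟩
    · obtain ⟨n, rfl⟩ : ∃ m, n = m + 3 := ⟨n - 3, by omega⟩
      obtain ⟨a, ha, ha'⟩ := ih n (by omega)
      obtain ⟨b, hb, hb'⟩ := ih (n + 1) (by omega)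
      refine ⟨-qBracket K a (qBracket K a b), Submodule.neg_mem _
        (bracket_mem_generatedSubalgebra K ha (bracket_mem_generatedSubalgebra K ha hb)), ?_⟩
      rw [Submodule.coe_neg, coe_qBracket, coe_qBracket, ha', hb', superBracket_pivot_pivot,
        neg_neg]

/-- Two brackets with `v_{2k}` turn `v_{2k+1}` into `-v_{2k+3}`, so the index grows by two along
with the position in the lower central series. -/
theorem exists_pivot_mem_lowerSeries (k : ℕ) :
    ∃ a ∈ lowerSeries (qBracket K) (generatedSubalgebra (qBracket K) (Set.range (qGen K))) (2 * k),
      (a : Module.End K (Gr K)) = pivot K (2 * k + 1) := by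
  induction k with
  | zero => exact exists_pivot_mem_generatedSubalgebra K 1
  | succ k ih =>
    obtain ⟨b, hb, hb'⟩ := ih
    obtain ⟨a, ha, ha'⟩ := exists_pivot_mem_generatedSubalgebra K (2 * k)
    refine ⟨_, neg_bracket_bracket_mem_lowerSeries K ha hb, ?_⟩
    rw [Submodule.coe_neg, coe_qBracket, coe_qBracket, ha', hb', superBracket_pivot_pivot, neg_neg]
    rfl

/-- A zero pivot would contradict `v_n x_n + x_n v_n = 1`. -/
theorem pivot_ne_zero (n : ℕ) : pivot K n ≠ 0 := fun h0 => by
  have h := (isPivotSystem K).v_x_anticomm_self n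
  rw [h0, zero_mul, mul_zero, add_zero] at h
  have h1 : (0 : Gr K) = 1 := congrArg (fun φ : Module.End K (Gr K) => φ 1) h
  exact zero_ne_one h1

theorem not_isLocallyNilpotent_Q : ¬ IsLocallyNilpotent (L := Q K) (qBracket K) := fun h => by
  obtain ⟨n, hn⟩ := h (Set.range (qGen K)) (Set.finite_range _)
  obtain ⟨a, ha, ha'⟩ := exists_pivot_mem_lowerSeries K n
  rw [lowerSeries_eq_bot_of_le K hn (by omega), Submodule.mem_bot] at ha
  subst ha
  exact pivot_ne_zero K _ ha'.symm

end LocalNilpotency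

end

end FractalQ

theorem mainTheorem4 (K : Type*) [Field K] :
    -- `Q = Q_0 ⊕ Q_1` is a Lie superalgebra
    FractalQ.IsLieSuperalgebra (L := FractalQ.Q K) (FractalQ.qParity K) (FractalQ.qBracket K) ∧
    -- `ad a` is nilpotent for every even or odd element `a` of `Q`
    (∀ i : ZMod 2, ∀ a ∈ FractalQ.qParity K i, IsNilpotent (FractalQ.qBracket K a)) ∧
    -- in characteristic zero, `Q` has a `ℤ³`-grading with `ad`-nilpotent homogeneous elements
    -- and components of dimension at most one, but is not locally nilpotent
    (CharZero K →
      FractalQ.IsGroupGrading (L := FractalQ.Q K) (FractalQ.qComponent K) (FractalQ.qBracket K) ∧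
      (∀ γ : Fin 3 → ℤ,
        FractalQ.qComponent K γ ≤ FractalQ.qParity K ((γ 0 + γ 1 + γ 2 : ℤ) : ZMod 2)) ∧
      (∀ γ : Fin 3 → ℤ, Module.rank K (FractalQ.qComponent K γ) ≤ 1) ∧
      (∀ γ : Fin 3 → ℤ, ∀ a ∈ FractalQ.qComponent K γ, IsNilpotent (FractalQ.qBracket K a)) ∧
      ¬ FractalQ.IsLocallyNilpotent (L := FractalQ.Q K) (FractalQ.qBracket K)) :=
  ⟨FractalQ.isLieSuperalgebra_Q K, fun _ _ ha => FractalQ.isNilpotent_qBracket K ha, fun _ =>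
    ⟨FractalQ.isGroupGrading_qComponent K, FractalQ.qComponent_le_qParity K,
      FractalQ.rank_qComponent_le_one K,
      fun γ _ ha => FractalQ.isNilpotent_qBracket K (FractalQ.qComponent_le_qParity K γ ha),
      FractalQ.not_isLocallyNilpotent_Q K⟩⟩
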